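/- Let $n\ge 1$ and $\delta\in\mathbb R$. For Schwartz functions $f,g$ on $\mathbb R^n$ let $$S^\delta(f,g)(x)=\iint_{|\xi|^2+|\eta|^2\le 1}\bigl(1-|\xi|^2-|\eta|^2\bigr)^{\delta}\,\widehat f(\xi)\,\widehat g(\eta)\,e^{2\pi i x\cdot(\xi+\eta)}\,d\xi\,d\eta,\qquad x\in\mathbb R^n,$$ where $\widehat f(\xi)=\int_{\mathbb R^n}e^{-2\pi i x\cdot\xi}f(x)\,dx$. Let $p,q,r'\in[2,\infty)$ satisfy $\frac1p+\frac1q+\frac1{r'}=1$, and let $r$ be the conjugate exponent of $r'$, that is, $\frac1r+\frac1{r'}=1$ (equivalently $\frac1r=\frac1p+\frac1q$). If $\delta>\frac{n-1}{r'}$, then $S^\delta$ is bounded from $L^p(\mathbb R^n)\times L^q(\mathbb R^n)$ to $L^r(\mathbb R^n)$; that is, $S^\delta$ extends to a bilinear operator $L^p(\mathbb R^n)\times L^q(\mathbb R^n)\to L^r(\mathbb R^n)$ for which there is a constant $C$ with $$\|S^\delta(f,g)\|_{L^r}\le C\,\|f\|_{L^p}\|g\|_{L^q}\qquad\text{for all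 } f\in L^p(\mathbb R^n),\ g\in L^q(\mathbb R^n).$$ -/

import Mathlib

open MeasureTheory
open scoped ENNReal SchwartzMap FourierTransform

/-- The bilinear Bochner-Riesz operator `S^δ` on Schwartz functions on `ℝⁿ`:
`S^δ(f, g)(x) = ∬_{|ξ|² + |η|² ≤ 1} e^{2πi x·(ξ + η)} (1 - |ξ|² - |η|²)^δ f̂(ξ) ĝ(η) dξ dη`,
where `f̂(ξ) = ∫ e^{-2πi x·ξ} f(x) dx`. -/
noncomputable def bilinearBochnerRiesz (n : ℕ) (δ : ℝ)
    (f g : 𝓢(EuclideanSpace ℝ (Fin n), ℂ)) (x : EuclideanSpace ℝ (Fin n)) : ℂ :=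
  ∫ z in {z : EuclideanSpace ℝ (Fin n) × EuclideanSpace ℝ (Fin n) |
      ‖z.1‖ ^ 2 + ‖z.2‖ ^ 2 ≤ 1},
    Complex.exp (2 * (Real.pi : ℂ) * Complex.I * ((inner ℝ x (z.1 + z.2) : ℝ) : ℂ)) *
      (((1 - ‖z.1‖ ^ 2 - ‖z.2‖ ^ 2) ^ δ : ℝ) : ℂ) * (𝓕 f) z.1 * (𝓕 g) z.2

/-- An operator `T`, given on pairs of Schwartz functions, is bounded from
`L^p(ℝⁿ) × L^q(ℝⁿ)` to `L^r(ℝⁿ)`: it extends to a bilinear operator `B` on these spaces with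
`‖B(f, g)‖_r ≤ C ‖f‖_p ‖g‖_q`. -/
def IsBoundedBilinear {n : ℕ}
    (T : 𝓢(EuclideanSpace ℝ (Fin n), ℂ) → 𝓢(EuclideanSpace ℝ (Fin n), ℂ) →
      EuclideanSpace ℝ (Fin n) → ℂ) (p q r : ℝ≥0∞) : Prop :=
  ∃ B : Lp ℂ p (volume : Measure (EuclideanSpace ℝ (Fin n))) →ₗ[ℂ]
      Lp ℂ q (volume : Measure (EuclideanSpace ℝ (Fin n))) →ₗ[ℂ]
      Lp ℂ r (volume : Measure (EuclideanSpace ℝ (Fin n))),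
    (∃ C : ℝ, ∀ f g, ‖B f g‖ ≤ C * ‖f‖ * ‖g‖) ∧
    ∀ f g : 𝓢(EuclideanSpace ℝ (Fin n), ℂ),
      (B (f.toLp p volume) (g.toLp q volume) : EuclideanSpace ℝ (Fin n) → ℂ)
        =ᵐ[volume] T f g

/-!
Laplace inversion along the line `Re b = 1` writes `(1 - s)₊ ^ δ` as a superposition of the
exponentials `exp (-b s)`, with a density of size `‖b‖ ^ (-(δ + 1))`. At `s = ‖ξ‖² + ‖η‖²` each
exponential factors, so `S^δ(f, g) = ∫ density(b) · H_b f · H_b g db`, where `H_b` is the linear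
multiplier operator with symbol `exp (-b ‖ξ‖²)`.

On the part of the line where `‖b‖ ≈ N = 2 ^ j`, Cauchy-Schwarz in `b` leaves the product of the
square functions of `f` and `g`. Plancherel bounds the square function on `L²` by `N ^ (1 / 2)`. On
`L^∞` it is bounded by `N ^ (d / 2 + ε)`: the kernel of `H_b` is concentrated on a ball of radius
about `N`, and there the phase is analysed as a power series in `conj b / b`, whose powers are
orthogonal on the line. Interpolation gives `N ^ (d / 2 - (d - 1) / p + ε)` on `L^p`, and by
Hölder the blocks contribute `N ^ ((d - 1) (1 - 1 / r) - δ + 2 ε)`, which is summable over `j`.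
-/

open Set Filter Topology

section Marcinkiewicz

variable {α β E : Type*} [MeasurableSpace α] [MeasurableSpace β] [NormedAddCommGroup E]
  {μ : Measure α} {ν : Measure β}

lemma lintegral_Ioo_rpow {s M : ℝ} (hs : -1 < s) (hM : 0 ≤ M) :
    ∫⁻ t in Ioo 0 M, ENNReal.ofReal (t ^ s) = ENNReal.ofReal (M ^ (s + 1) / (s + 1)) := by
  have hint : IntegrableOn (fun t : ℝ => t ^ s) (Ioc 0 M) :=
    (intervalIntegrable_iff_integrableOn_Ioc_of_le hM).1
      (intervalIntegral.intervalIntegrable_rpow' hs)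
  have hnonneg : ∀ᵐ t ∂volume.restrict (Ioc 0 M), 0 ≤ t ^ s := by
    filter_upwards [ae_restrict_mem measurableSet_Ioc] with t ht using Real.rpow_nonneg ht.1.le _
  rw [Measure.restrict_congr_set Ioo_ae_eq_Ioc, ← ofReal_integral_eq_lintegral_ofReal hint hnonneg,
    ← intervalIntegral.integral_of_le hM, integral_rpow (Or.inl hs),
    Real.zero_rpow (by linarith), sub_zero]

lemma nullMeasurableSet_lt_norm {f : α → E} (hf : AEStronglyMeasurable f μ) (l : ℝ) :
    NullMeasurableSet {x | l < ‖f x‖} μ :=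
  nullMeasurableSet_lt aemeasurable_const hf.norm.aemeasurable

lemma memLp_indicator_lt_norm {f : α → E} {p q : ℝ≥0∞} (hf : MemLp f p μ) (hp0 : p ≠ 0)
    (hptop : p ≠ ⊤) (hqp : q ≤ p) {l : ℝ} (hl : 0 < l) :
    MemLp ({x | l < ‖f x‖}.indicator f) q μ := by
  have hfinite : μ {x | l < ‖f x‖} ≠ ⊤ := by
    refine ne_top_of_le_ne_top
      (hf.meas_ge_lt_top hp0 hptop (ε := l.toNNReal) (by simpa using hl)).ne (measure_mono ?_)
    intro x (hx : l < ‖f x‖)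
    exact Real.toNNReal_le_iff_le_coe.2 hx.le
  refine MemLp.mono_exponent_of_measure_support_ne_top (s := {x | l < ‖f x‖}) ?_
    (fun x hx => indicator_of_notMem hx f) hfinite hqp
  exact hf.mono (hf.1.indicator₀ (nullMeasurableSet_lt_norm hf.1 l))
    (Eventually.of_forall fun x => norm_indicator_le_norm_self f x)

lemma eLpNorm_top_indicator_compl_lt_norm_le (f : α → E) (l : ℝ) :
    eLpNorm ({x | l < ‖f x‖}ᶜ.indicator f) ⊤ μ ≤ ENNReal.ofReal l := by
  refine eLpNormEssSup_le_of_ae_enorm_bound (Eventually.of_forall fun x => ?_)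
  by_cases hx : l < ‖f x‖
  · simp [hx]
  · rw [indicator_of_mem (by exact hx), ← ofReal_norm]
    exact ENNReal.ofReal_le_ofReal (not_lt.1 hx)

lemma memLp_top_indicator_compl_lt_norm {f : α → E} (hf : AEStronglyMeasurable f μ) (l : ℝ) :
    MemLp ({x | l < ‖f x‖}ᶜ.indicator f) ⊤ μ :=
  ⟨hf.indicator₀ (nullMeasurableSet_lt_norm hf l).compl,
    (eLpNorm_top_indicator_compl_lt_norm_le f l).trans_lt ENNReal.ofReal_lt_top⟩

lemma lintegral_Ioi_rpow_mul_indicator {q p c : ℝ} (hq : 0 ≤ q) (hqp : q < p) (hc : 0 < c) (a : E) :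
    ∫⁻ t in Ioi (0 : ℝ), ENNReal.ofReal (t ^ (p - 1 - q)) *
        (Iio (c * ‖a‖)).indicator (fun _ => ‖a‖ₑ ^ q) t =
      ENNReal.ofReal (c ^ (p - q) / (p - q)) * ‖a‖ₑ ^ p := by
  have hpq : 0 < p - q := sub_pos.2 hqp
  calc _ = ∫⁻ t in Ioo 0 (c * ‖a‖), ENNReal.ofReal (t ^ (p - 1 - q)) * ‖a‖ₑ ^ q := by
        simp_rw [← indicator_mul_right (Iio (c * ‖a‖)) fun t => ENNReal.ofReal (t ^ (p - 1 - q))]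
        rw [setLIntegral_indicator measurableSet_Iio, inter_comm, Ioi_inter_Iio]
    _ = ENNReal.ofReal ((c * ‖a‖) ^ (p - q) / (p - q)) * ‖a‖ₑ ^ q := by
        rw [lintegral_mul_const' _ _ (by finiteness),
          lintegral_Ioo_rpow (by linarith) (by positivity)]
        ring_nf
    _ = _ := by
        rw [Real.mul_rpow hc.le (norm_nonneg _), mul_div_right_comm,
          ENNReal.ofReal_mul (by positivity),
          ← ENNReal.ofReal_rpow_of_nonneg (norm_nonneg _) hpq.le,
          ofReal_norm, mul_assoc, ← ENNReal.rpow_add_of_nonneg _ _ hpq.le hq, sub_add_cancel]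

theorem lintegral_Ioi_rpow_mul_setLIntegral_lt_norm [SFinite μ] {f : α → E}
    (hf : AEStronglyMeasurable f μ) {q p c : ℝ} (hq : 0 ≤ q) (hqp : q < p) (hc : 0 < c) :
    ∫⁻ t in Ioi (0 : ℝ), ENNReal.ofReal (t ^ (p - 1 - q)) *
        ∫⁻ x, {x | t / c < ‖f x‖}.indicator (fun x => ‖f x‖ₑ ^ q) x ∂μ =
      ENNReal.ofReal (c ^ (p - q) / (p - q)) * ∫⁻ x, ‖f x‖ₑ ^ p ∂μ := by
  have hsnd : AEStronglyMeasurable (fun z : ℝ × α => f z.2) ((volume.restrict (Ioi 0)).prod μ) :=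
    hf.comp_snd
  have hswap (t : ℝ) (x : α) : {x | t / c < ‖f x‖}.indicator (fun x => ‖f x‖ₑ ^ q) x =
      (Iio (c * ‖f x‖)).indicator (fun _ => ‖f x‖ₑ ^ q) t := by
    simp only [indicator_apply, mem_ofPred_eq, mem_Iio, div_lt_iff₀' hc]
  have hjoint : AEMeasurable (fun z : ℝ × α => ENNReal.ofReal (z.1 ^ (p - 1 - q)) *
      {z : ℝ × α | z.1 / c < ‖f z.2‖}.indicator (fun z => ‖f z.2‖ₑ ^ q) z)
      ((volume.restrict (Ioi 0)).prod μ) :=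
    AEMeasurable.mul (by fun_prop) ((hsnd.enorm.pow_const q).indicator₀
      (nullMeasurableSet_lt (by fun_prop) hsnd.norm.aemeasurable))
  calc _ = ∫⁻ t in Ioi (0 : ℝ), ∫⁻ x, ENNReal.ofReal (t ^ (p - 1 - q)) *
        {x | t / c < ‖f x‖}.indicator (fun x => ‖f x‖ₑ ^ q) x ∂μ := by
        simp_rw [lintegral_const_mul' _ _ ENNReal.ofReal_ne_top]
    _ = ∫⁻ x, (∫⁻ t in Ioi (0 : ℝ), ENNReal.ofReal (t ^ (p - 1 - q)) *
        {x | t / c < ‖f x‖}.indicator (fun x => ‖f x‖ₑ ^ q) x) ∂μ := lintegral_lintegral_swap hjoint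
    _ = ∫⁻ x, ENNReal.ofReal (c ^ (p - q) / (p - q)) * ‖f x‖ₑ ^ p ∂μ := by
        simp_rw [hswap, lintegral_Ioi_rpow_mul_indicator hq hqp hc]
    _ = _ := lintegral_const_mul' _ _ ENNReal.ofReal_ne_top

lemma eLpNorm_indicator_rpow {q : ℝ≥0∞} (hq : q ≠ 0) (hqtop : q ≠ ⊤) (s : Set α) (f : α → E) :
    eLpNorm (s.indicator f) q μ ^ q.toReal =
      ∫⁻ x, s.indicator (fun x => ‖f x‖ₑ ^ q.toReal) x ∂μ := by
  have hq0 : 0 < q.toReal := ENNReal.toReal_pos hq hqtop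
  rw [eLpNorm_eq_eLpNorm' hq hqtop, eLpNorm'_eq_lintegral_enorm, ← ENNReal.rpow_mul,
    one_div_mul_cancel hq0.ne', ENNReal.rpow_one]
  refine lintegral_congr fun x => ?_
  by_cases hx : x ∈ s <;> simp [hx, hq0]

/-- The hypotheses of the Marcinkiewicz interpolation theorem between `L^q` and `L^∞`: the operator
`T`, with values in nonnegative functions, is subadditive on `L^q + L^∞` and of strong types
`(q, q)` and `(∞, ∞)` with constants `A` and `B`. -/
structure IsSubadditiveOfStrongType (T : (α → E) → β → ℝ≥0∞) (q : ℝ≥0∞) (A B : ℝ) (μ : Measure α)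
    (ν : Measure β) : Prop where
  add_le : ∀ u v, MemLp u q μ → MemLp v ⊤ μ → ∀ᵐ y ∂ν, T (u + v) y ≤ T u y + T v y
  aemeasurable : ∀ u, MemLp u q μ → AEMeasurable (T u) ν
  eLpNorm_le : ∀ u, MemLp u q μ → eLpNorm (T u) q ν ≤ ENNReal.ofReal A * eLpNorm u q μ
  eLpNorm_top_le : ∀ u, MemLp u ⊤ μ → eLpNorm (T u) ⊤ ν ≤ ENNReal.ofReal B * eLpNorm u ⊤ μ

namespace IsSubadditiveOfStrongType

variable {T : (α → E) → β → ℝ≥0∞} {q p : ℝ≥0∞} {A B : ℝ} {f : α → E}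

lemma ae_le_indicator_add (hT : IsSubadditiveOfStrongType T q A B μ ν) (hB : 0 < B)
    (hf : MemLp f p μ) (hqp : q < p) (hp : p ≠ ⊤) {l : ℝ} (hl : 0 < l) :
    ∀ᵐ y ∂ν, T f y ≤ T ({x | l < ‖f x‖}.indicator f) y + ENNReal.ofReal (B * l) := by
  have hlarge := memLp_indicator_lt_norm hf (pos_of_gt hqp).ne' hp hqp.le hl
  have hsmall := memLp_top_indicator_compl_lt_norm hf.1 l
  have hbound : eLpNorm (T ({x | l < ‖f x‖}ᶜ.indicator f)) ⊤ ν ≤ ENNReal.ofReal (B * l) := by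
    refine (hT.eLpNorm_top_le _ hsmall).trans ?_
    rw [ENNReal.ofReal_mul hB.le]
    gcongr
    exact eLpNorm_top_indicator_compl_lt_norm_le f l
  have hadd := hT.add_le _ _ hlarge hsmall
  rw [indicator_self_add_compl] at hadd
  filter_upwards [hadd, ae_le_eLpNormEssSup (f := T ({x | l < ‖f x‖}ᶜ.indicator f))] with y hy hyB
  exact hy.trans (add_le_add_right (hyB.trans hbound) _)

lemma ae_lt_top (hT : IsSubadditiveOfStrongType T q A B μ ν) (hB : 0 < B)
    (hf : MemLp f p μ) (hq : q ≠ 0) (hqp : q < p) (hp : p ≠ ⊤) : ∀ᵐ y ∂ν, T f y < ⊤ := by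
  have hlarge := memLp_indicator_lt_norm hf (pos_of_gt hqp).ne' hp hqp.le one_pos
  have hfinite : eLpNorm (T ({x | 1 < ‖f x‖}.indicator f)) q ν < ⊤ :=
    (hT.eLpNorm_le _ hlarge).trans_lt (ENNReal.mul_lt_top ENNReal.ofReal_lt_top hlarge.2)
  have hae := ae_lt_top' ((hT.aemeasurable _ hlarge).enorm.pow_const q.toReal)
    (lintegral_rpow_enorm_lt_top_of_eLpNorm_lt_top hq hqp.ne_top hfinite).ne
  filter_upwards [hT.ae_le_indicator_add hB hf hqp hp one_pos, hae] with y hy hyfin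
  refine hy.trans_lt (ENNReal.add_lt_top.2 ⟨?_, ENNReal.ofReal_lt_top⟩)
  exact (ENNReal.rpow_lt_top_iff_of_pos (ENNReal.toReal_pos hq hqp.ne_top)).1 hyfin

lemma meas_lt_le (hT : IsSubadditiveOfStrongType T q A B μ ν) (hA : 0 ≤ A) (hB : 0 < B)
    (hf : MemLp f p μ) (hq : q ≠ 0) (hqp : q < p) (hp : p ≠ ⊤) {t : ℝ} (ht : 0 < t) :
    ν {y | t < (T f y).toReal} ≤ ENNReal.ofReal ((2 * A / t) ^ q.toReal) *
      ∫⁻ x, {x | t / (2 * B) < ‖f x‖}.indicator (fun x => ‖f x‖ₑ ^ q.toReal) x ∂μ := by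
  set l := t / (2 * B) with hl_def
  have hl : 0 < l := by positivity
  have hBl : B * l = t / 2 := by rw [hl_def]; field_simp
  have hlarge := memLp_indicator_lt_norm hf (pos_of_gt hqp).ne' hp hqp.le hl
  set u := {x | l < ‖f x‖}.indicator f
  have hq0 : 0 < q.toReal := ENNReal.toReal_pos hq hqp.ne_top
  calc ν {y | t < (T f y).toReal} ≤ ν {y | ENNReal.ofReal (t / 2) ≤ ‖T u y‖ₑ} := by
        refine measure_mono_ae ?_
        filter_upwards [hT.ae_le_indicator_add hB hf hqp hp hl] with y hy (hty : t < _)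
        have hsum : ENNReal.ofReal (t / 2) + ENNReal.ofReal (t / 2) ≤
            T u y + ENNReal.ofReal (t / 2) := by
          rw [← ENNReal.ofReal_add (by positivity) (by positivity), add_halves, ← hBl]
          exact (ENNReal.ofReal_le_of_le_toReal hty.le).trans hy
        exact (ENNReal.add_le_add_iff_right ENNReal.ofReal_ne_top).1 hsum
    _ ≤ (ENNReal.ofReal (t / 2))⁻¹ ^ q.toReal * eLpNorm (T u) q ν ^ q.toReal :=
        meas_ge_le_mul_pow_eLpNorm_enorm ν hq hqp.ne_top
          (hT.aemeasurable u hlarge).aestronglyMeasurable (by simpa using ht) (by simp)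
    _ ≤ (ENNReal.ofReal (t / 2))⁻¹ ^ q.toReal *
          (ENNReal.ofReal A * eLpNorm u q μ) ^ q.toReal := by
        gcongr
        exact hT.eLpNorm_le u hlarge
    _ = _ := by
        rw [ENNReal.mul_rpow_of_nonneg _ _ hq0.le, eLpNorm_indicator_rpow hq hqp.ne_top,
          ← mul_assoc,
          ← ENNReal.mul_rpow_of_nonneg _ _ hq0.le, ← ENNReal.ofReal_inv_of_pos (by positivity),
          ← ENNReal.ofReal_mul (by positivity),
          ENNReal.ofReal_rpow_of_nonneg (by positivity) hq0.le]
        congr 3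
        field_simp

theorem lintegral_rpow_le [SFinite μ] (hT : IsSubadditiveOfStrongType T q A B μ ν) (hA : 0 ≤ A)
    (hB : 0 < B) (hTf : AEMeasurable (T f) ν) (hf : MemLp f p μ) (hq : q ≠ 0) (hqp : q < p)
    (hp : p ≠ ⊤) :
    ∫⁻ y, T f y ^ p.toReal ∂ν ≤
      ENNReal.ofReal (p.toReal * 2 ^ p.toReal / (p.toReal - q.toReal) * A ^ q.toReal *
        B ^ (p.toReal - q.toReal)) * ∫⁻ x, ‖f x‖ₑ ^ p.toReal ∂μ := by
  have hq0 : 0 < q.toReal := ENNReal.toReal_pos hq hqp.ne_top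
  have hqp' : q.toReal < p.toReal := (ENNReal.toReal_lt_toReal hqp.ne_top hp).2 hqp
  have hp0 : 0 < p.toReal := hq0.trans hqp'
  have hpq : 0 < p.toReal - q.toReal := sub_pos.2 hqp'
  calc ∫⁻ y, T f y ^ p.toReal ∂ν = ∫⁻ y, ENNReal.ofReal ((T f y).toReal ^ p.toReal) ∂ν := by
        refine lintegral_congr_ae ?_
        filter_upwards [hT.ae_lt_top hB hf hq hqp hp] with y hy
        rw [← ENNReal.ofReal_rpow_of_nonneg ENNReal.toReal_nonneg hp0.le,
          ENNReal.ofReal_toReal hy.ne]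
    _ = ENNReal.ofReal p.toReal * ∫⁻ t in Ioi 0, ν {y | t < (T f y).toReal} *
          ENNReal.ofReal (t ^ (p.toReal - 1)) :=
        lintegral_rpow_eq_lintegral_meas_lt_mul ν (Eventually.of_forall fun y =>
          ENNReal.toReal_nonneg) hTf.ennreal_toReal hp0
    _ ≤ ENNReal.ofReal p.toReal * ∫⁻ t in Ioi (0 : ℝ), ENNReal.ofReal ((2 * A) ^ q.toReal) *
          (ENNReal.ofReal (t ^ (p.toReal - 1 - q.toReal)) *
          ∫⁻ x, {x | t / (2 * B) < ‖f x‖}.indicator (fun x => ‖f x‖ₑ ^ q.toReal) x ∂μ) := by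
        gcongr 1
        refine setLIntegral_mono' measurableSet_Ioi fun t (ht : 0 < t) => ?_
        refine (mul_le_mul_left (hT.meas_lt_le hA hB hf hq hqp hp ht) _).trans_eq ?_
        rw [Real.div_rpow (by positivity) ht.le, Real.rpow_sub ht (p.toReal - 1),
          div_eq_mul_inv (_ ^ _), div_eq_mul_inv (t ^ _), ENNReal.ofReal_mul (by positivity),
          ENNReal.ofReal_mul (by positivity)]
        ring
    _ = _ := by
        rw [lintegral_const_mul' _ _ ENNReal.ofReal_ne_top,
          lintegral_Ioi_rpow_mul_setLIntegral_lt_norm hf.1 hq0.le hqp' (by positivity),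
          ← mul_assoc, ← mul_assoc, ← ENNReal.ofReal_mul hp0.le,
          ← ENNReal.ofReal_mul (by positivity)]
        congr 2
        rw [Real.mul_rpow zero_le_two hA, Real.mul_rpow zero_le_two hB.le, Real.rpow_sub two_pos]
        field_simp

theorem eLpNorm_le_of_lt [SFinite μ] (hT : IsSubadditiveOfStrongType T q A B μ ν) (hA : 0 ≤ A)
    (hB : 0 < B) (hTf : AEMeasurable (T f) ν) (hf : MemLp f p μ) (hq : q ≠ 0) (hqp : q < p)
    (hp : p ≠ ⊤) :
    eLpNorm (T f) p ν ≤
      ENNReal.ofReal ((p.toReal * 2 ^ p.toReal / (p.toReal - q.toReal)) ^ (1 / p.toReal) *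
        A ^ (q.toReal / p.toReal) * B ^ (1 - q.toReal / p.toReal)) * eLpNorm f p μ := by
  have hq0 : 0 < q.toReal := ENNReal.toReal_pos hq hqp.ne_top
  have hqp' : q.toReal < p.toReal := (ENNReal.toReal_lt_toReal hqp.ne_top hp).2 hqp
  have hp0 : 0 < p.toReal := hq0.trans hqp'
  have hpq : 0 < p.toReal - q.toReal := sub_pos.2 hqp'
  have hpzero : p ≠ 0 := (pos_of_gt hqp).ne'
  rw [eLpNorm_eq_lintegral_rpow_enorm_toReal hpzero hp,
    eLpNorm_eq_lintegral_rpow_enorm_toReal hpzero hp]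
  refine (ENNReal.rpow_le_rpow (hT.lintegral_rpow_le hA hB hTf hf hq hqp hp)
    (by positivity)).trans_eq ?_
  rw [ENNReal.mul_rpow_of_nonneg _ _ (by positivity),
    ENNReal.ofReal_rpow_of_nonneg (by positivity) (by positivity),
    Real.mul_rpow (by positivity) (by positivity), Real.mul_rpow (by positivity) (by positivity),
    ← Real.rpow_mul hA, ← Real.rpow_mul hB.le]
  congr 4 <;> field_simp

end IsSubadditiveOfStrongType

end Marcinkiewicz

section NonnegLp

variable {α : Type*} [MeasurableSpace α] {μ : Measure α}

lemma ae_lt_top_of_eLpNorm_ne_top {p : ℝ≥0∞} (hp : p ≠ 0) {u : α → ℝ≥0∞} (hu : AEMeasurable u μ)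
    (hfin : eLpNorm u p μ ≠ ⊤) : ∀ᵐ x ∂μ, u x < ⊤ := by
  rcases eq_or_ne p ⊤ with rfl | hptop
  · filter_upwards [ae_le_eLpNormEssSup (f := u)] with x hx using hx.trans_lt hfin.lt_top
  · have hint := lintegral_rpow_enorm_lt_top_of_eLpNorm_lt_top hp hptop hfin.lt_top
    filter_upwards [ae_lt_top' (hu.enorm.pow_const _) hint.ne] with x hx
    exact (ENNReal.rpow_lt_top_iff_of_pos (ENNReal.toReal_pos hp hptop)).1 hx

lemma eLpNorm_ennreal_mul_le {p q r : ℝ≥0∞} [ENNReal.HolderTriple p q r] (hp : p ≠ 0) (hq : q ≠ 0)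
    {u v : α → ℝ≥0∞} (hu : AEMeasurable u μ) (hv : AEMeasurable v μ)
    (hufin : eLpNorm u p μ ≠ ⊤) (hvfin : eLpNorm v q μ ≠ ⊤) :
    eLpNorm (fun x => u x * v x) r μ ≤ eLpNorm u p μ * eLpNorm v q μ := by
  have hreal {w : α → ℝ≥0∞} (hw : ∀ᵐ x ∂μ, w x < ⊤) : ∀ᵐ x ∂μ, ‖(w x).toReal‖ₑ = ‖w x‖ₑ := by
    filter_upwards [hw] with x hx
    rw [Real.enorm_of_nonneg ENNReal.toReal_nonneg, ENNReal.ofReal_toReal hx.ne, enorm_eq_self]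
  have hu' := ae_lt_top_of_eLpNorm_ne_top hp hu hufin
  have hv' := ae_lt_top_of_eLpNorm_ne_top hq hv hvfin
  have huv' : ∀ᵐ x ∂μ, u x * v x < ⊤ := by
    filter_upwards [hu', hv'] with x hux hvx using ENNReal.mul_lt_top hux hvx
  calc eLpNorm (fun x => u x * v x) r μ
      = eLpNorm ((fun x => (u x).toReal) • fun x => (v x).toReal) r μ := by
        refine (eLpNorm_congr_enorm_ae ?_).symm
        simpa only [ENNReal.toReal_mul] using! hreal huv'
    _ ≤ eLpNorm (fun x => (u x).toReal) p μ * eLpNorm (fun x => (v x).toReal) q μ :=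
        eLpNorm_smul_le_mul_eLpNorm hv.ennreal_toReal.aestronglyMeasurable
          hu.ennreal_toReal.aestronglyMeasurable
    _ = eLpNorm u p μ * eLpNorm v q μ := by
        rw [eLpNorm_congr_enorm_ae (hreal hu'), eLpNorm_congr_enorm_ae (hreal hv')]

lemma eLpNorm_iSup_of_monotone {p : ℝ≥0∞} {u : ℕ → α → ℝ≥0∞} (hu : ∀ n, AEMeasurable (u n) μ)
    (hmono : Monotone u) : eLpNorm (fun x => ⨆ n, u n x) p μ = ⨆ n, eLpNorm (u n) p μ := by
  rcases eq_or_ne p 0 with rfl | hp0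
  · simp
  rcases eq_or_ne p ⊤ with rfl | hptop
  · simp only [eLpNorm_exponent_top]
    refine le_antisymm (essSup_le_of_ae_le _ ?_)
      (iSup_le fun n => essSup_mono_ae (Eventually.of_forall fun x => le_iSup (u · x) n))
    filter_upwards [ae_all_iff.2 fun n => ae_le_eLpNormEssSup (f := u n) (μ := μ)] with x hx
    exact iSup_mono hx
  · have hpow := ENNReal.toReal_pos hp0 hptop
    simp only [eLpNorm_eq_lintegral_rpow_enorm_toReal hp0 hptop, enorm_eq_self]
    have hsup {s : ℝ} (hs : 0 < s) (c : ℕ → ℝ≥0∞) : (⨆ n, c n) ^ s = ⨆ n, c n ^ s :=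
      (ENNReal.orderIsoRpow s hs).map_iSup c
    simp_rw [hsup hpow]
    rw [lintegral_iSup' (fun n => (hu n).pow_const _)
      (Eventually.of_forall fun x n m hnm => ENNReal.rpow_le_rpow (hmono hnm x) hpow.le)]
    exact hsup (by positivity) _

theorem eLpNorm_tsum_le {p : ℝ≥0∞} (hp : 1 ≤ p) {u : ℕ → α → ℝ≥0∞}
    (hu : ∀ n, AEMeasurable (u n) μ) :
    eLpNorm (fun x => ∑' n, u n x) p μ ≤ ∑' n, eLpNorm (u n) p μ := by
  have hmono : Monotone fun N x => ∑ n ∈ Finset.range N, u n x := fun N M hNM x =>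
    Finset.sum_le_sum_of_subset (Finset.range_mono hNM)
  simp_rw [ENNReal.tsum_eq_iSup_nat]
  rw [eLpNorm_iSup_of_monotone (fun N => Finset.aemeasurable_fun_sum _ fun n _ => hu n) hmono]
  refine iSup_mono fun N => ?_
  simpa only [Finset.sum_fn] using
    eLpNorm_sum_le (fun n _ => (hu n).aestronglyMeasurable) hp (s := Finset.range N)

end NonnegLp

section Plancherel

variable {V H : Type*} [NormedAddCommGroup V] [InnerProductSpace ℝ V] [FiniteDimensional ℝ V]
  [MeasurableSpace V] [BorelSpace V] [NormedAddCommGroup H] [InnerProductSpace ℂ H]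
  [CompleteSpace H]

lemma integral_fourierInv_smul_eq {ψ : V → ℂ} {φ : V → H} (hψ : Integrable ψ)
    (hφ : Integrable φ) : ∫ x, (𝓕⁻ ψ) x • φ x = ∫ x, ψ x • (𝓕⁻ φ) x := by
  have hflip : (-innerₗ V).flip = -innerₗ V := by
    ext x y
    simp [real_inner_comm]
  simpa only [hflip] using! VectorFourier.integral_fourierIntegral_smul_eq_flip
    (μ := (volume : Measure V)) (ν := (volume : Measure V)) (L := -innerₗ V)
    Real.continuous_fourierChar (by simpa using! continuous_inner.neg) hψ hφ

theorem coeFn_fourierInv_toLp_ae_eq {φ : V → H} (h1 : Integrable φ) (h2 : MemLp φ 2) :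
    ((𝓕⁻ (h2.toLp φ) : Lp H 2 (volume : Measure V)) : V → H) =ᵐ[volume] 𝓕⁻ φ := by
  set G : Lp H 2 (volume : Measure V) := 𝓕⁻ (h2.toLp φ) with hG
  have hcont : Continuous (𝓕⁻ φ) :=
    VectorFourier.fourierIntegral_continuous Real.continuous_fourierChar
      (L := -innerₗ V) (by simpa using! continuous_inner.neg) h1
  refine ae_eq_of_integral_contDiff_smul_eq ((Lp.memLp G).locallyIntegrable one_le_two)
    hcont.locallyIntegrable fun g hg hgs => ?_
  let ψ : 𝓢(V, ℂ) := (hgs.comp_left (g := ((↑) : ℝ → ℂ)) rfl).toSchwartzMap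
    (Complex.ofRealCLM.contDiff.comp hg)
  have hψ (x : V) : ψ x = (g x : ℂ) := rfl
  have hdual : ∫ x, ψ x • G x = ∫ x, (𝓕⁻ ψ) x • φ x := by
    rw [← Lp.toTemperedDistribution_apply (μ := volume) G ψ, hG,
      ← Lp.fourierInv_toTemperedDistribution_eq, TemperedDistribution.fourierInv_apply,
      Lp.toTemperedDistribution_apply]
    refine integral_congr_ae ?_
    filter_upwards [h2.coeFn_toLp] with x hx
    rw [hx]
  have hswap : ∫ x, (𝓕⁻ ψ) x • φ x = ∫ x, ψ x • (𝓕⁻ φ) x := by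
    rw [SchwartzMap.fourierInv_coe]
    exact integral_fourierInv_smul_eq ψ.integrable h1
  simpa [hψ] using hdual.trans hswap

theorem eLpNorm_fourierInv_eq {φ : V → H} (h1 : Integrable φ) (h2 : MemLp φ 2) :
    eLpNorm (𝓕⁻ φ) 2 = eLpNorm φ 2 := by
  have hnorm : ‖(𝓕⁻ (h2.toLp φ) : Lp H 2 (volume : Measure V))‖ₑ = ‖h2.toLp φ‖ₑ := by
    rw [← ofReal_norm, ← ofReal_norm, ← Lp.norm_fourier_eq, FourierTransform.fourier_fourierInv_eq]
  rwa [Lp.enorm_def, Lp.enorm_def, eLpNorm_congr_ae (coeFn_fourierInv_toLp_ae_eq h1 h2),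
    eLpNorm_congr_ae h2.coeFn_toLp] at hnorm

lemma eLpNorm_fourier_schwartz_eq (f : 𝓢(V, H)) : eLpNorm (𝓕 f : 𝓢(V, H)) 2 = eLpNorm f 2 := by
  have hnorm : ‖(𝓕 f).toLp 2 (volume : Measure V)‖ₑ = ‖f.toLp 2 (volume : Measure V)‖ₑ := by
    rw [← ofReal_norm, ← ofReal_norm, f.norm_fourier_toL2_eq]
  rwa [Lp.enorm_def, Lp.enorm_def, eLpNorm_congr_ae ((𝓕 f).coeFn_toLp 2 _),
    eLpNorm_congr_ae (f.coeFn_toLp 2 _)] at hnorm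

end Plancherel

section GaussianKernel

lemma norm_cexp_neg_mul_ofReal_le_one {b : ℂ} {s : ℝ} (hb : 0 ≤ b.re) (hs : 0 ≤ s) :
    ‖Complex.exp (-b * s)‖ ≤ 1 := by
  rw [Complex.norm_exp, Real.exp_le_one_iff, Complex.re_mul_ofReal, Complex.neg_re]
  exact mul_nonpos_of_nonpos_of_nonneg (neg_nonpos.2 hb) hs

variable {V : Type*} [NormedAddCommGroup V] [InnerProductSpace ℝ V]

/-- The complex Gaussian on `V` whose Fourier transform is `exp (-b ‖ξ‖²)`, for `0 < b.re`. -/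
noncomputable def gaussKernel (b : ℂ) (y : V) : ℂ :=
  (Real.pi / b) ^ (Module.finrank ℝ V / 2 : ℂ) * Complex.exp (-Real.pi ^ 2 * ‖y‖ ^ 2 / b)

lemma norm_gaussKernel (b : ℂ) (y : V) :
    ‖gaussKernel b y‖ = (Real.pi / ‖b‖) ^ (Module.finrank ℝ V / 2 : ℝ) *
      Real.exp (-(Real.pi ^ 2 * (b.re / ‖b‖ ^ 2)) * ‖y‖ ^ 2) := by
  have hre : (-Real.pi ^ 2 * ‖y‖ ^ 2 / b : ℂ).re =
      -(Real.pi ^ 2 * (b.re / ‖b‖ ^ 2)) * ‖y‖ ^ 2 := by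
    rw [div_eq_mul_inv, show (-Real.pi ^ 2 * ‖y‖ ^ 2 : ℂ) = ((-Real.pi ^ 2 * ‖y‖ ^ 2 : ℝ) : ℂ) by
      push_cast; rfl, Complex.re_ofReal_mul, Complex.inv_re, Complex.normSq_eq_norm_sq]
    ring
  rw [gaussKernel, norm_mul, Complex.norm_exp, hre,
    show (Module.finrank ℝ V / 2 : ℂ) = ((Module.finrank ℝ V / 2 : ℝ) : ℂ) by push_cast; rfl,
    Complex.norm_cpow_real, norm_div, Complex.norm_of_nonneg Real.pi_pos.le]

lemma continuous_gaussKernel (b : ℂ) : Continuous (gaussKernel b : V → ℂ) := by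
  unfold gaussKernel
  fun_prop

variable [FiniteDimensional ℝ V] [MeasurableSpace V] [BorelSpace V]

lemma integrable_exp_neg_mul_sq_norm {c : ℝ} (hc : 0 < c) :
    Integrable (fun y : V => Real.exp (-c * ‖y‖ ^ 2)) := by
  refine (GaussianFourier.integrable_cexp_neg_mul_sq_norm_add (V := V) (b := c)
    (by simpa using hc) 0 0).norm.congr (Eventually.of_forall fun y => ?_)
  simp [Complex.norm_exp, ← Complex.ofReal_pow]

lemma memLp_gaussKernel {b : ℂ} (hb : 0 < b.re) (s : ℝ≥0∞) :
    MemLp (gaussKernel b : V → ℂ) s := by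
  have hb0 : b ≠ 0 := by rintro rfl; simp at hb
  have hc : 0 < Real.pi ^ 2 * (b.re / ‖b‖ ^ 2) := by positivity
  have hmeas := (continuous_gaussKernel (V := V) b).aestronglyMeasurable (μ := volume)
  rcases eq_or_ne s 0 with rfl | hs0
  · exact memLp_zero_iff_aestronglyMeasurable.2 hmeas
  rcases eq_or_ne s ⊤ with rfl | hs
  · refine memLp_top_of_bound hmeas ((Real.pi / ‖b‖) ^ (Module.finrank ℝ V / 2 : ℝ))
      (Eventually.of_forall fun y => ?_)
    rw [norm_gaussKernel b]
    refine mul_le_of_le_one_right (by positivity) (Real.exp_le_one_iff.2 ?_)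
    rw [neg_mul, neg_nonpos]
    positivity
  rw [← integrable_norm_rpow_iff hmeas hs0 hs]
  have hs' : 0 < s.toReal := ENNReal.toReal_pos hs0 hs
  refine ((integrable_exp_neg_mul_sq_norm (V := V) (mul_pos hc hs')).const_mul
    (((Real.pi / ‖b‖) ^ (Module.finrank ℝ V / 2 : ℝ)) ^ s.toReal)).congr
    (Eventually.of_forall fun y => ?_)
  simp only [norm_gaussKernel b]
  rw [Real.mul_rpow (by positivity) (by positivity), ← Real.exp_mul]
  ring_nf

lemma memLp_gaussKernel_sub {b : ℂ} (hb : 0 < b.re) (s : ℝ≥0∞) (x : V) :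
    MemLp (fun y : V => gaussKernel b (x - y)) s :=
  (memLp_gaussKernel hb s).comp_measurePreserving (Measure.measurePreserving_sub_left volume x)

/-- Convolution with `gaussKernel b`: the Fourier multiplier operator with symbol
`exp (-b ‖ξ‖²)`. -/
noncomputable def heatOp (b : ℂ) (f : V → ℂ) (x : V) : ℂ :=
  ∫ y, gaussKernel b (x - y) * f y

lemma heatOp_smul (b c : ℂ) (f : V → ℂ) (x : V) : heatOp b (c • f) x = c * heatOp b f x := by
  simp only [heatOp, Pi.smul_apply, smul_eq_mul, ← integral_const_mul, mul_left_comm]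

lemma heatOp_congr_ae (b : ℂ) {f g : V → ℂ} (h : f =ᵐ[volume] g) (x : V) :
    heatOp b f x = heatOp b g x := by
  refine integral_congr_ae ?_
  filter_upwards [h] with y hy
  rw [hy]

lemma measurable_heatOp {α : Type*} [MeasurableSpace α] {c : α → ℂ} {x : α → V} {f : V → ℂ}
    (hc : Measurable c) (hx : Measurable x) (hf : AEStronglyMeasurable f volume) :
    Measurable fun a => heatOp (c a) f (x a) := by
  have hkernel : Measurable fun q : α × V =>
      gaussKernel (c q.1) (x q.1 - q.2) * hf.mk f q.2 := by
    have := hf.stronglyMeasurable_mk.measurable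
    unfold gaussKernel
    fun_prop
  simp_rw [fun a => heatOp_congr_ae (c a) hf.ae_eq_mk (x a)]
  exact (hkernel.stronglyMeasurable.integral_prod_right' (ν := volume)).measurable

variable {b : ℂ}

lemma integrable_gaussKernel_mul (hb : 0 < b.re) {p : ℝ≥0∞} (hp : 1 ≤ p) {f : V → ℂ}
    (hf : MemLp f p) (x : V) : Integrable (fun y : V => gaussKernel b (x - y) * f y) :=
  have : ENNReal.HolderConjugate p.conjExponent p :=
    (ENNReal.HolderConjugate.conjExponent hp).symm
  (memLp_gaussKernel_sub hb p.conjExponent x).integrable_mul hf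

lemma heatOp_add (hb : 0 < b.re) {p q : ℝ≥0∞} (hp : 1 ≤ p) (hq : 1 ≤ q) {f g : V → ℂ}
    (hf : MemLp f p) (hg : MemLp g q) (x : V) :
    heatOp b (f + g) x = heatOp b f x + heatOp b g x := by
  simp only [heatOp, Pi.add_apply, mul_add]
  exact integral_add (integrable_gaussKernel_mul hb hp hf x) (integrable_gaussKernel_mul hb hq hg x)

lemma continuous_heatOp_Lp (hb : 0 < b.re) {p : ℝ≥0∞} [hp : Fact (1 ≤ p)] (x : V) :
    Continuous fun f : Lp ℂ p (volume : Measure V) => heatOp b f x := by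
  have : ENNReal.HolderConjugate p.conjExponent p :=
    (ENNReal.HolderConjugate.conjExponent hp.out).symm
  have : Fact (1 ≤ p.conjExponent) := ⟨ENNReal.HolderConjugate.one_le p.conjExponent p⟩
  have hK := memLp_gaussKernel_sub hb p.conjExponent x
  have hpair (f : Lp ℂ p (volume : Measure V)) : heatOp b f x =
      (ContinuousLinearMap.mul ℂ ℂ).lpPairing volume p.conjExponent p (hK.toLp _) f := by
    rw [ContinuousLinearMap.lpPairing_eq_integral]
    refine integral_congr_ae ?_
    filter_upwards [hK.coeFn_toLp] with y hy
    rw [ContinuousLinearMap.mul_apply', hy]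
  simp_rw [hpair]
  fun_prop

lemma heatOp_schwartz_eq (hb : 0 < b.re) (f : 𝓢(V, ℂ)) :
    heatOp b f = 𝓕⁻ (fun ξ => Complex.exp (-b * ‖ξ‖ ^ 2) * 𝓕 f ξ) := by
  ext x
  have hgauss (y : V) : VectorFourier.fourierIntegral Real.fourierChar volume (innerₗ V)
      (fun v : V => Complex.exp (-b * ‖v‖ ^ 2 + 2 * Real.pi * Complex.I * inner ℝ x v)) y =
      gaussKernel b (x - y) := fourier_gaussian_innerProductSpace' hb x y
  have hswap := VectorFourier.integral_fourierIntegral_smul_eq_flip (μ := (volume : Measure V))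
    (ν := (volume : Measure V)) (L := innerₗ V)
    Real.continuous_fourierChar (by simpa using! continuous_inner)
    (GaussianFourier.integrable_cexp_neg_mul_sq_norm_add hb (2 * Real.pi * Complex.I) x)
    f.integrable
  simp_rw [flip_innerₗ, hgauss] at hswap
  rw [Real.fourierInv_eq']
  refine hswap.trans (integral_congr_ae (Eventually.of_forall fun ξ => ?_))
  have hf : VectorFourier.fourierIntegral Real.fourierChar volume (innerₗ V) f ξ = 𝓕 f ξ := rfl
  simp only [hf, smul_eq_mul]
  rw [Complex.exp_add, real_inner_comm]
  push_cast
  ring_nf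

lemma eLpNorm_heatOp_schwartz_le (hb : 0 < b.re) (f : 𝓢(V, ℂ)) :
    eLpNorm (heatOp b f) 2 ≤ eLpNorm f 2 := by
  let F : 𝓢(V, ℂ) := 𝓕 f
  let φ : V → ℂ := fun ξ => Complex.exp (-b * ‖ξ‖ ^ 2) * F ξ
  have hle (ξ : V) : ‖φ ξ‖ ≤ ‖F ξ‖ := by
    rw [norm_mul]
    exact mul_le_of_le_one_left (norm_nonneg _)
      (mod_cast norm_cexp_neg_mul_ofReal_le_one hb.le (sq_nonneg ‖ξ‖))
  have hmeas : AEStronglyMeasurable φ volume :=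
    Continuous.aestronglyMeasurable (.mul (by fun_prop) F.continuous)
  calc eLpNorm (heatOp b f) 2 volume = eLpNorm (𝓕⁻ φ) 2 volume := by rw [heatOp_schwartz_eq hb]
    _ = eLpNorm φ 2 volume := eLpNorm_fourierInv_eq
        (F.integrable.mono hmeas (Eventually.of_forall hle))
        ((F.memLp 2).mono hmeas (Eventually.of_forall hle))
    _ ≤ eLpNorm F 2 volume := eLpNorm_mono hle
    _ = eLpNorm f 2 volume := eLpNorm_fourier_schwartz_eq f

theorem eLpNorm_heatOp_le (hb : 0 < b.re) {f : V → ℂ} (hf : MemLp f 2) :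
    eLpNorm (heatOp b f) 2 ≤ eLpNorm f 2 := by
  have hclosed : IsClosed {g : Lp ℂ 2 (volume : Measure V) | eLpNorm (heatOp b g) 2 ≤ ‖g‖ₑ} := by
    refine isSeqClosed_iff_isClosed.1 fun u g hu hlim => ?_
    have hmeas (k : ℕ) : AEStronglyMeasurable (heatOp b (u k)) volume :=
      (measurable_heatOp measurable_const measurable_id
        (Lp.aestronglyMeasurable (u k))).aestronglyMeasurable
    calc eLpNorm (heatOp b g) 2 volume
        ≤ liminf (fun k => eLpNorm (heatOp b (u k)) 2 volume) atTop :=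
          Lp.eLpNorm_lim_le_liminf_eLpNorm hmeas (heatOp b g) (Eventually.of_forall fun x =>
            ((continuous_heatOp_Lp hb x).tendsto g).comp hlim)
      _ ≤ liminf (fun k => ‖u k‖ₑ) atTop := liminf_le_liminf (Eventually.of_forall hu)
      _ = ‖g‖ₑ := ((continuous_enorm.tendsto g).comp hlim).liminf_eq
  have hschwartz (φ : 𝓢(V, ℂ)) :
      eLpNorm (heatOp b (φ.toLp 2 volume)) 2 ≤ ‖φ.toLp 2 (volume : Measure V)‖ₑ := by
    rw [funext (heatOp_congr_ae b (φ.coeFn_toLp 2 volume)), Lp.enorm_def,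
      eLpNorm_congr_ae (φ.coeFn_toLp 2 volume)]
    exact eLpNorm_heatOp_schwartz_le hb φ
  have hLp : eLpNorm (heatOp b (hf.toLp f)) 2 ≤ ‖hf.toLp f‖ₑ :=
    (SchwartzMap.denseRange_toLpCLM (E := V) (F := ℂ) (p := 2)
      (μ := (volume : Measure V)) ENNReal.ofNat_ne_top).induction_on (hf.toLp f) hclosed hschwartz
  rwa [Lp.enorm_def, eLpNorm_congr_ae hf.coeFn_toLp,
    funext (heatOp_congr_ae b hf.coeFn_toLp)] at hLp

end GaussianKernel

section VerticalLine

open ComplexConjugate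

/-- The parametrization `1 + 2πit` of the line `Re b = 1`. -/
noncomputable def vertLine (t : ℝ) : ℂ := 1 + 2 * Real.pi * t * Complex.I

@[simp] lemma vertLine_re (t : ℝ) : (vertLine t).re = 1 := by simp [vertLine]

@[simp] lemma vertLine_im (t : ℝ) : (vertLine t).im = 2 * Real.pi * t := by simp [vertLine]

lemma vertLine_re_pos (t : ℝ) : 0 < (vertLine t).re := by simp

lemma vertLine_ne_zero (t : ℝ) : vertLine t ≠ 0 := fun h => by
  simpa using congrArg Complex.re h

@[fun_prop] lemma continuous_vertLine : Continuous vertLine := by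
  unfold vertLine
  fun_prop

@[fun_prop] lemma measurable_vertLine : Measurable vertLine := continuous_vertLine.measurable

lemma hasDerivAt_vertLine (t : ℝ) : HasDerivAt vertLine (2 * Real.pi * Complex.I) t := by
  have hderiv := (((hasDerivAt_id (t : ℂ)).const_mul (2 * Real.pi : ℂ)).mul_const
    Complex.I).const_add 1
  exact hderiv.comp_ofReal.congr_deriv (by simp)

lemma norm_vertLine_sq (t : ℝ) : ‖vertLine t‖ ^ 2 = 1 + (2 * Real.pi * t) ^ 2 := by
  rw [← Complex.normSq_eq_norm_sq, Complex.normSq_apply, vertLine_re, vertLine_im]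
  ring

lemma one_le_norm_vertLine (t : ℝ) : 1 ≤ ‖vertLine t‖ := by
  simpa using Complex.re_le_norm (vertLine t)

lemma norm_vertLine_pos (t : ℝ) : 0 < ‖vertLine t‖ := one_pos.trans_le (one_le_norm_vertLine t)

lemma abs_le_norm_vertLine (t : ℝ) : |t| ≤ ‖vertLine t‖ :=
  calc |t| ≤ 2 * Real.pi * |t| := le_mul_of_one_le_left (abs_nonneg t) (by
        linarith [Real.pi_gt_three])
    _ = |(vertLine t).im| := by rw [vertLine_im, abs_mul, abs_of_pos Real.two_pi_pos]
    _ ≤ ‖vertLine t‖ := Complex.abs_im_le_norm _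

lemma tendsto_norm_vertLine : Tendsto (fun t => ‖vertLine t‖) (cocompact ℝ) atTop :=
  tendsto_atTop_mono abs_le_norm_vertLine (tendsto_norm_cocompact_atTop (E := ℝ))

lemma integrable_inv_norm_vertLine_sq : Integrable (fun t => 1 / ‖vertLine t‖ ^ 2) := by
  simpa only [norm_vertLine_sq, one_div] using
    integrable_inv_one_add_sq.comp_mul_left' (R := 2 * Real.pi) (by positivity)

lemma integral_inv_norm_vertLine_sq : ∫ t, 1 / ‖vertLine t‖ ^ 2 = 1 / 2 := by
  simp only [norm_vertLine_sq, one_div]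
  rw [Measure.integral_comp_mul_left (fun x : ℝ => (1 + x ^ 2)⁻¹), integral_univ_inv_one_add_sq,
    abs_of_pos (by positivity), smul_eq_mul]
  field_simp

/-- The parametrization `b̄ / b`, with `b = 1 + 2πit`, of the unit circle without `-1`. -/
noncomputable def cayley (t : ℝ) : ℂ := conj (vertLine t) / vertLine t

lemma cayley_eq (t : ℝ) : cayley t = 2 / vertLine t - 1 := by
  have hconj : conj (vertLine t) = 2 - vertLine t := by
    simp only [vertLine, map_add, map_one, map_mul, Complex.conj_ofReal, Complex.conj_I,
      map_ofNat]
    ring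
  rw [cayley, hconj, sub_div, div_self (vertLine_ne_zero t)]

lemma norm_cayley (t : ℝ) : ‖cayley t‖ = 1 := by
  rw [cayley, norm_div, RCLike.norm_conj, div_self (norm_vertLine_pos t).ne']

lemma cayley_ne_zero (t : ℝ) : cayley t ≠ 0 := norm_ne_zero_iff.1 (by simp [norm_cayley])

lemma conj_cayley (t : ℝ) : conj (cayley t) = (cayley t)⁻¹ :=
  (Complex.inv_eq_conj (norm_cayley t)).symm

@[fun_prop] lemma continuous_cayley : Continuous cayley := by
  unfold cayley
  exact (Complex.continuous_conj.comp continuous_vertLine).div continuous_vertLine vertLine_ne_zero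

lemma hasDerivAt_cayley (t : ℝ) :
    HasDerivAt cayley (-(4 * Real.pi * Complex.I) * cayley t * ((1 / ‖vertLine t‖ ^ 2 : ℝ) : ℂ))
      t := by
  have hconj : conj (vertLine t) ≠ 0 := by simpa using vertLine_ne_zero t
  have hderiv := ((hasDerivAt_const t (2 : ℂ)).div (hasDerivAt_vertLine t)
    (vertLine_ne_zero t)).sub_const 1
  refine (hderiv.congr_deriv ?_).congr_of_eventuallyEq (Eventually.of_forall cayley_eq)
  rw [Complex.ofReal_div, ← Complex.normSq_eq_norm_sq, ← Complex.mul_conj,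
    Complex.ofReal_one, cayley]
  field_simp [vertLine_ne_zero t]
  ring

lemma tendsto_cayley : Tendsto cayley (cocompact ℝ) (𝓝 (-1)) := by
  have hdiv : Tendsto (fun t => 2 / vertLine t) (cocompact ℝ) (𝓝 0) := by
    rw [tendsto_zero_iff_norm_tendsto_zero]
    simp only [norm_div]
    exact tendsto_norm_vertLine.const_div_atTop _
  rw [funext cayley_eq]
  simpa using hdiv.sub_const 1

lemma integrable_cayley_zpow_div (m : ℤ) :
    Integrable (fun t => cayley t ^ m * ((1 / ‖vertLine t‖ ^ 2 : ℝ) : ℂ)) :=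
  integrable_inv_norm_vertLine_sq.ofReal.bdd_mul (c := 1)
    (continuous_cayley.zpow₀ m fun t => Or.inl (cayley_ne_zero t)).aestronglyMeasurable
    (Eventually.of_forall fun t => by simp [norm_cayley])

lemma integral_cayley_zpow_div_of_ne_zero {m : ℤ} (hm : m ≠ 0) :
    ∫ t, cayley t ^ m * ((1 / ‖vertLine t‖ ^ 2 : ℝ) : ℂ) = 0 := by
  set κ : ℂ := (m : ℂ) * (-(4 * Real.pi * Complex.I)) with hκ
  have hκ0 : κ ≠ 0 := by simp [hκ, hm, Real.pi_ne_zero]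
  have hderiv (t : ℝ) : HasDerivAt (fun t => κ⁻¹ * cayley t ^ m)
      (cayley t ^ m * ((1 / ‖vertLine t‖ ^ 2 : ℝ) : ℂ)) t := by
    refine (((hasDerivAt_zpow m (cayley t) (Or.inl (cayley_ne_zero t))).comp t
      (hasDerivAt_cayley t)).const_mul κ⁻¹).congr_deriv ?_
    rw [inv_mul_eq_iff_eq_mul₀ hκ0, hκ, zpow_sub_one₀ (cayley_ne_zero t)]
    field_simp [cayley_ne_zero t]
  have hlim : Tendsto (fun t => κ⁻¹ * cayley t ^ m) (cocompact ℝ) (𝓝 (κ⁻¹ * (-1) ^ m)) :=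
    (tendsto_cayley.zpow₀ m (Or.inl (by norm_num))).const_mul _
  rw [integral_of_hasDerivAt_of_tendsto hderiv (integrable_cayley_zpow_div m)
    (hlim.mono_left atBot_le_cocompact) (hlim.mono_left atTop_le_cocompact), sub_self]

lemma integral_cayley_zpow_sub_div (j k : ℕ) :
    ∫ t, cayley t ^ ((j : ℤ) - k) * ((1 / ‖vertLine t‖ ^ 2 : ℝ) : ℂ) =
      if j = k then 1 / 2 else 0 := by
  split_ifs with h
  · simp only [h, sub_self, zpow_zero, one_mul]
    rw [integral_complex_ofReal, integral_inv_norm_vertLine_sq]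
    norm_num
  · exact integral_cayley_zpow_div_of_ne_zero (sub_ne_zero.2 (by exact_mod_cast h))

lemma integral_norm_sum_cayley_sq (s : Finset ℕ) (c : ℕ → ℂ) :
    ∫ t, ‖∑ k ∈ s, c k * cayley t ^ k‖ ^ 2 * (1 / ‖vertLine t‖ ^ 2) =
      1 / 2 * ∑ k ∈ s, ‖c k‖ ^ 2 := by
  have hexpand (t : ℝ) :
      ((‖∑ k ∈ s, c k * cayley t ^ k‖ ^ 2 * (1 / ‖vertLine t‖ ^ 2) : ℝ) : ℂ) =
        ∑ j ∈ s, ∑ k ∈ s, c j * conj (c k) *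
          (cayley t ^ ((j : ℤ) - k) * ((1 / ‖vertLine t‖ ^ 2 : ℝ) : ℂ)) := by
    rw [Complex.ofReal_mul, Complex.ofReal_pow, ← Complex.mul_conj', map_sum, Finset.sum_mul_sum,
      Finset.sum_mul]
    refine Finset.sum_congr rfl fun j _ => ?_
    rw [Finset.sum_mul]
    refine Finset.sum_congr rfl fun k _ => ?_
    rw [map_mul, map_pow, conj_cayley, zpow_sub₀ (cayley_ne_zero t), zpow_natCast, zpow_natCast,
      inv_pow]
    ring
  have hint (j k : ℕ) := (integrable_cayley_zpow_div (j - k)).const_mul (c j * conj (c k))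
  rw [← Complex.ofReal_inj, ← integral_complex_ofReal]
  simp_rw [hexpand]
  rw [integral_finsetSum _ fun j _ => integrable_finsetSum _ fun k _ => hint j k]
  simp_rw [integral_finsetSum _ fun k _ => hint _ k, integral_const_mul,
    integral_cayley_zpow_sub_div]
  push_cast
  rw [Finset.mul_sum]
  refine Finset.sum_congr rfl fun j hj => ?_
  simp only [mul_ite, mul_zero, Finset.sum_ite_eq, hj, if_true, Complex.mul_conj']
  ring

lemma lintegral_enorm_sum_cayley_sq_le (s : Finset ℕ) (c : ℕ → ℂ) :
    ∫⁻ t, ‖∑ k ∈ s, c k * cayley t ^ k‖ₑ ^ 2 * ENNReal.ofReal (1 / ‖vertLine t‖ ^ 2) ≤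
      ∑ k ∈ s, ‖c k‖ₑ ^ 2 := by
  have hint : Integrable fun t => ‖∑ k ∈ s, c k * cayley t ^ k‖ ^ 2 * (1 / ‖vertLine t‖ ^ 2) := by
    refine integrable_inv_norm_vertLine_sq.bdd_mul (c := (∑ k ∈ s, ‖c k‖) ^ 2)
      (Continuous.aestronglyMeasurable (by fun_prop)) (Eventually.of_forall fun t => ?_)
    rw [norm_pow, norm_norm]
    refine pow_le_pow_left₀ (norm_nonneg _) ((norm_sum_le _ _).trans_eq ?_) 2
    simp [norm_cayley]
  have henorm (z : ℂ) : ‖z‖ₑ ^ 2 = ENNReal.ofReal (‖z‖ ^ 2) := by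
    rw [ENNReal.ofReal_pow (norm_nonneg _), ofReal_norm]
  simp only [henorm, ← ENNReal.ofReal_mul (sq_nonneg _)]
  rw [← ofReal_integral_eq_lintegral_ofReal hint (Eventually.of_forall fun t => by positivity),
    integral_norm_sum_cayley_sq, ← ENNReal.ofReal_sum_of_nonneg fun _ _ => by positivity]
  exact ENNReal.ofReal_le_ofReal (mul_le_of_le_one_left (by positivity) (by norm_num))

theorem lintegral_enorm_sq_le_tsum_of_hasSum_cayley {c : ℕ → ℂ} {G : ℝ → ℂ}
    (h : ∀ t, HasSum (fun k => c k * cayley t ^ k) (G t)) :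
    ∫⁻ t, ‖G t‖ₑ ^ 2 * ENNReal.ofReal (1 / ‖vertLine t‖ ^ 2) ≤ ∑' k, ‖c k‖ₑ ^ 2 := by
  let u (N : ℕ) (t : ℝ) : ℝ≥0∞ := ‖∑ k ∈ Finset.range N, c k * cayley t ^ k‖ₑ ^ 2 *
    ENNReal.ofReal (1 / ‖vertLine t‖ ^ 2)
  have hlim (t : ℝ) : Tendsto (u · t) atTop
      (𝓝 (‖G t‖ₑ ^ 2 * ENNReal.ofReal (1 / ‖vertLine t‖ ^ 2))) :=
    ENNReal.Tendsto.mul_const (((ENNReal.continuous_pow 2).comp continuous_enorm).tendsto _ |>.comp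
      (h t).tendsto_sum_nat) (Or.inr ENNReal.ofReal_ne_top)
  have hmeas (N : ℕ) : Measurable (u N) := by fun_prop
  calc ∫⁻ t, ‖G t‖ₑ ^ 2 * ENNReal.ofReal (1 / ‖vertLine t‖ ^ 2)
      = ∫⁻ t, liminf (u · t) atTop := lintegral_congr fun t => (hlim t).liminf_eq.symm
    _ ≤ liminf (fun N => ∫⁻ t, u N t) atTop := lintegral_liminf_le hmeas
    _ ≤ ∑' k, ‖c k‖ₑ ^ 2 := liminf_le_of_frequently_le' (Frequently.of_forall fun N =>
        (lintegral_enorm_sum_cayley_sq_le _ c).trans (ENNReal.sum_le_tsum _))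

end VerticalLine

section PoissonWeight

/-- The probability that a Poisson variable with mean `π² r² / 2` equals `k`. -/
noncomputable def poissonWeight (k : ℕ) (r : ℝ) : ℝ :=
  Real.exp (-(Real.pi ^ 2 * r ^ 2 / 2)) * (Real.pi ^ 2 * r ^ 2 / 2) ^ k / k.factorial

lemma poissonWeight_nonneg (k : ℕ) (r : ℝ) : 0 ≤ poissonWeight k r := by
  unfold poissonWeight
  positivity

@[fun_prop] lemma continuous_poissonWeight (k : ℕ) : Continuous (poissonWeight k) := by
  unfold poissonWeight
  fun_prop

lemma hasSum_poissonWeight (r : ℝ) : HasSum (fun k => poissonWeight k r) 1 := by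
  have h := (NormedSpace.expSeries_div_hasSum_exp (Real.pi ^ 2 * r ^ 2 / 2)).mul_left
    (Real.exp (-(Real.pi ^ 2 * r ^ 2 / 2)))
  rw [← Real.exp_eq_exp_ℝ, ← Real.exp_add, neg_add_cancel, Real.exp_zero] at h
  exact h.congr_fun fun k => mul_div_assoc _ _ _

lemma tsum_ofReal_poissonWeight (r : ℝ) : ∑' k, ENNReal.ofReal (poissonWeight k r) = 1 := by
  rw [← ENNReal.ofReal_tsum_of_nonneg (fun k => poissonWeight_nonneg k r)
    (hasSum_poissonWeight r).summable, (hasSum_poissonWeight r).tsum_eq, ENNReal.ofReal_one]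

lemma poissonWeight_le_one (k : ℕ) (r : ℝ) : poissonWeight k r ≤ 1 :=
  le_hasSum (hasSum_poissonWeight r) k fun j _ => poissonWeight_nonneg j r

lemma mul_poissonWeight_eq (k : ℕ) (r : ℝ) :
    r * poissonWeight k r = ((Real.pi ^ 2 / 2) ^ k / k.factorial) *
      (r ^ (2 * k + 1 : ℝ) * Real.exp (-(Real.pi ^ 2 / 2) * r ^ (2 : ℝ))) := by
  have hpow : r ^ (2 * k + 1 : ℝ) = r ^ (2 * k + 1) := by exact_mod_cast Real.rpow_natCast r _
  rw [hpow, Real.rpow_two, poissonWeight, pow_succ r (2 * k), pow_mul r,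
    show Real.pi ^ 2 * r ^ 2 / 2 = Real.pi ^ 2 / 2 * r ^ 2 by ring, mul_pow, neg_mul]
  ring

lemma integrableOn_mul_poissonWeight (k : ℕ) :
    IntegrableOn (fun r => r * poissonWeight k r) (Ioi 0) := by
  simp only [mul_poissonWeight_eq]
  exact (integrableOn_rpow_mul_exp_neg_mul_rpow (by linarith [k.cast_nonneg (α := ℝ)])
    (by norm_num) (by positivity)).const_mul _

lemma integral_mul_poissonWeight (k : ℕ) :
    ∫ r in Ioi (0 : ℝ), r * poissonWeight k r = 1 / Real.pi ^ 2 := by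
  have hk : ((2 * k + 1 + 1 : ℝ)) / 2 = k + 1 := by ring
  have hfact : (k.factorial : ℝ) ≠ 0 := by positivity
  simp only [mul_poissonWeight_eq]
  rw [integral_const_mul, integral_rpow_mul_exp_neg_mul_rpow (by norm_num)
      (by linarith [k.cast_nonneg (α := ℝ)]) (by positivity), neg_div, hk,
    Real.Gamma_nat_eq_factorial, Real.rpow_neg (by positivity), Real.rpow_add_one (by positivity),
    Real.rpow_natCast]
  field_simp

lemma hasSum_poissonWeight_mul_cayley (r t : ℝ) :
    HasSum (fun k => (poissonWeight k r : ℂ) * (-cayley t) ^ k)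
      (Complex.exp (-Real.pi ^ 2 * r ^ 2 / vertLine t)) := by
  set a : ℂ := Real.pi ^ 2 * r ^ 2 / 2 with ha
  have hexp : (-Real.pi ^ 2 * r ^ 2 / vertLine t : ℂ) = -a + a * (-cayley t) := by
    rw [cayley_eq, ha]
    ring
  have h := (NormedSpace.expSeries_div_hasSum_exp (a * (-cayley t))).mul_left (Complex.exp (-a))
  rw [← Complex.exp_eq_exp_ℂ, ← Complex.exp_add, ← hexp] at h
  refine h.congr_fun fun k => ?_
  rw [poissonWeight, mul_pow]
  push_cast
  rw [ha]
  ring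

end PoissonWeight

section RadialIntegrals

lemma pow_sub_one_mul_rpow {d : ℕ} (hd : 1 ≤ d) {r : ℝ} (hr : 0 < r) (s : ℝ) :
    r ^ (d - 1) * r ^ s = r ^ (d - 1 + s : ℝ) := by
  rw [Real.rpow_add hr, ← Real.rpow_natCast, Nat.cast_sub hd, Nat.cast_one]

variable {V : Type*} [NormedAddCommGroup V] [InnerProductSpace ℝ V] [FiniteDimensional ℝ V]
  [MeasurableSpace V] [BorelSpace V] [Nontrivial V]

lemma lintegral_ofReal_comp_norm_le {F G : ℝ → ℝ} (hF : Measurable F) (hF0 : ∀ r, 0 ≤ r → 0 ≤ F r)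
    (hG : IntegrableOn G (Ioi 0)) (h : ∀ r, 0 < r → r ^ (Module.finrank ℝ V - 1) * F r ≤ G r) :
    ∫⁻ y : V, ENNReal.ofReal (F ‖y‖) ≤ ENNReal.ofReal
      (Module.finrank ℝ V * (volume : Measure V).real (Metric.ball 0 1) *
        ∫ r in Ioi (0 : ℝ), G r) := by
  have hI : IntegrableOn (fun r : ℝ => r ^ (Module.finrank ℝ V - 1) • F r) (Ioi 0) := by
    refine Integrable.mono' hG (Measurable.aestronglyMeasurable (by fun_prop)) ?_
    filter_upwards [ae_restrict_mem measurableSet_Ioi] with r (hr : 0 < r)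
    rw [smul_eq_mul, Real.norm_of_nonneg (mul_nonneg (by positivity) (hF0 r hr.le))]
    exact h r hr
  rw [← ofReal_integral_eq_lintegral_ofReal ((integrable_fun_norm_addHaar volume).2 hI)
    (ae_of_all _ fun y => hF0 _ (norm_nonneg y)), integral_fun_norm_addHaar, nsmul_eq_mul,
    smul_eq_mul, ← mul_assoc]
  gcongr ENNReal.ofReal (_ * ?_)
  exact setIntegral_mono_on hI hG measurableSet_Ioi fun r hr => h r hr

lemma lintegral_ball_norm_rpow_le {s R : ℝ} (hs : 0 < Module.finrank ℝ V + s) (hR : 0 ≤ R) :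
    ∫⁻ y in Metric.ball (0 : V) R, ENNReal.ofReal (‖y‖ ^ s) ≤
      ENNReal.ofReal (Module.finrank ℝ V * (volume : Measure V).real (Metric.ball 0 1) *
        (R ^ (Module.finrank ℝ V + s) / (Module.finrank ℝ V + s))) := by
  set d : ℝ := (Module.finrank ℝ V : ℝ)
  have hint : IntervalIntegrable (fun r : ℝ => r ^ (d - 1 + s)) volume 0 R :=
    intervalIntegral.intervalIntegrable_rpow' (by linarith)
  rw [intervalIntegrable_iff_integrableOn_Ioo_of_le hR] at hint
  have hval : ∫ r in Ioi (0 : ℝ), (Ioo 0 R).indicator (fun r => r ^ (d - 1 + s)) r =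
      R ^ (d + s) / (d + s) := by
    rw [setIntegral_indicator measurableSet_Ioo, inter_eq_right.2 Ioo_subset_Ioi_self,
      ← integral_Ioc_eq_integral_Ioo, ← intervalIntegral.integral_of_le hR,
      integral_rpow (Or.inl (by linarith)), show d - 1 + s + 1 = d + s by ring,
      Real.zero_rpow hs.ne', sub_zero]
  rw [← hval, ← lintegral_indicator Metric.isOpen_ball.measurableSet]
  refine Eq.trans_le (lintegral_congr fun y => ?_) (lintegral_ofReal_comp_norm_le
    (F := (Iio R).indicator (· ^ s)) (Measurable.indicator (by fun_prop) measurableSet_Iio)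
    (fun r hr => indicator_apply_nonneg fun _ => by positivity)
    ((integrable_indicator_iff measurableSet_Ioo).2 hint).integrableOn fun r hr => ?_)
  · by_cases hy : ‖y‖ < R <;> simp [indicator, hy]
  · by_cases hrR : r < R <;>
      simp [indicator, hr, hrR, pow_sub_one_mul_rpow Module.finrank_pos hr, d]

lemma lintegral_poissonWeight_mul_norm_rpow_le {ε : ℝ} (hε : 0 ≤ ε) (hε1 : ε ≤ 1) (k : ℕ) :
    ∫⁻ y : V, ENNReal.ofReal (poissonWeight k ‖y‖ * ‖y‖ ^ (-(Module.finrank ℝ V - 2 + ε))) ≤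
      ENNReal.ofReal (Module.finrank ℝ V * (volume : Measure V).real (Metric.ball 0 1) *
        (2 + 2 * (1 / Real.pi ^ 2))) := by
  have hi₁ : IntegrableOn ((Ioo (0 : ℝ) 1).indicator fun _ => (2 : ℝ)) (Ioi 0) :=
    ((integrable_indicator_iff measurableSet_Ioo).2 (integrableOn_const (by simp))).integrableOn
  have hi₂ := (integrableOn_mul_poissonWeight k).const_mul 2
  have hval : ∫ r in Ioi (0 : ℝ), ((Ioo (0 : ℝ) 1).indicator (fun _ => (2 : ℝ)) r +
      2 * (r * poissonWeight k r)) = 2 + 2 * (1 / Real.pi ^ 2) := by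
    rw [integral_add hi₁ hi₂, integral_const_mul, integral_mul_poissonWeight,
      setIntegral_indicator measurableSet_Ioo, inter_eq_right.2 Ioo_subset_Ioi_self]
    simp
  rw [← hval]
  refine lintegral_ofReal_comp_norm_le
    (F := fun r => poissonWeight k r * r ^ (-(Module.finrank ℝ V - 2 + ε))) (by fun_prop)
    (fun r hr => mul_nonneg (poissonWeight_nonneg k r) (by positivity)) (hi₁.add hi₂) fun r hr => ?_
  have hw0 := poissonWeight_nonneg k r
  have hw1 := poissonWeight_le_one k r
  have hrε : r ^ (1 - ε) ≤ 1 + r :=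
    (Real.rpow_le_rpow hr.le (by linarith) (by linarith)).trans
      ((Real.rpow_le_rpow_of_exponent_le (by linarith) (by linarith)).trans_eq (Real.rpow_one _))
  calc r ^ (Module.finrank ℝ V - 1) * (poissonWeight k r * r ^ (-(Module.finrank ℝ V - 2 + ε)))
      = r ^ (1 - ε) * poissonWeight k r := by
        rw [mul_left_comm, pow_sub_one_mul_rpow Module.finrank_pos hr, mul_comm]
        ring_nf
    _ ≤ (1 + r) * poissonWeight k r := by gcongr
    _ ≤ _ := by
        by_cases hr1 : r < 1
        · simp only [indicator, mem_Ioo, hr, hr1, and_self, if_true]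
          nlinarith
        · simp only [indicator, mem_Ioo, hr1, and_false, if_false]
          nlinarith

end RadialIntegrals

section GaussianExtension

variable {V : Type*} [NormedAddCommGroup V] [InnerProductSpace ℝ V] [FiniteDimensional ℝ V]
  [MeasurableSpace V] [BorelSpace V]

lemma hasSum_integral_mul_poissonWeight {F : V → ℂ} (hF : Integrable F) (t : ℝ) :
    HasSum (fun k => ((-1) ^ k * ∫ y, F y * (poissonWeight k ‖y‖ : ℂ)) * cayley t ^ k)
      (∫ y, F y * Complex.exp (-Real.pi ^ 2 * ‖y‖ ^ 2 / vertLine t)) := by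
  have h : HasSum (fun k => ∫ y, F y * (poissonWeight k ‖y‖ * (-cayley t) ^ k))
      (∫ y, F y * Complex.exp (-Real.pi ^ 2 * ‖y‖ ^ 2 / vertLine t)) := by
    refine hasSum_integral_of_dominated_convergence (fun k y => ‖F y‖ * poissonWeight k ‖y‖)
      (fun k => ?_) (fun k => ae_of_all _ fun y => ?_)
      (ae_of_all _ fun y => (hasSum_poissonWeight ‖y‖).summable.mul_left _) ?_
      (ae_of_all _ fun y => (hasSum_poissonWeight_mul_cayley ‖y‖ t).mul_left _)
    · exact hF.aestronglyMeasurable.mul (Continuous.aestronglyMeasurable (by fun_prop))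
    · rw [norm_mul, norm_mul, norm_pow, norm_neg, norm_cayley, one_pow, mul_one,
        Complex.norm_of_nonneg (poissonWeight_nonneg _ _)]
    · simp only [tsum_mul_left, (hasSum_poissonWeight _).tsum_eq, mul_one]
      exact hF.norm
  refine h.congr_fun fun k => ?_
  simp only [← mul_assoc, integral_mul_const]
  rw [neg_pow]
  ring

lemma enorm_integral_mul_sq_le {α : Type*} [MeasurableSpace α] {μ : Measure α} {F : α → ℂ}
    {ρ ω : α → ℝ} (hF : AEStronglyMeasurable F μ) (hρ : AEMeasurable ρ μ) (hω : AEMeasurable ω μ)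
    (hρ0 : ∀ y, 0 ≤ ρ y) (hω0 : ∀ᵐ y ∂μ, 0 < ω y) :
    ‖∫ y, F y * (ρ y : ℂ) ∂μ‖ₑ ^ 2 ≤
      (∫⁻ y, ‖F y‖ₑ ^ 2 * ENNReal.ofReal (ω y) * ENNReal.ofReal (ρ y) ∂μ) *
        ∫⁻ y, ENNReal.ofReal (ρ y * (ω y)⁻¹) ∂μ := by
  have hsplit : ∀ᵐ y ∂μ, ‖F y * (ρ y : ℂ)‖ₑ =
      (‖F y‖ₑ ^ 2 * ENNReal.ofReal (ω y) * ENNReal.ofReal (ρ y)) ^ (1 / 2 : ℝ) *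
        ENNReal.ofReal (ρ y * (ω y)⁻¹) ^ (1 / 2 : ℝ) := by
    filter_upwards [hω0] with y hy
    rw [← ENNReal.mul_rpow_of_nonneg _ _ (by norm_num), mul_assoc, mul_assoc,
      ← ENNReal.ofReal_mul (hρ0 y), ← ENNReal.ofReal_mul hy.le,
      show ω y * (ρ y * (ρ y * (ω y)⁻¹)) = ρ y ^ 2 * (ω y * (ω y)⁻¹) by ring,
      mul_inv_cancel₀ hy.ne', mul_one, ENNReal.ofReal_pow (hρ0 y), ← mul_pow,
      ← ENNReal.rpow_natCast, ← ENNReal.rpow_mul, enorm_mul, ← ofReal_norm (ρ y : ℂ),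
      Complex.norm_of_nonneg (hρ0 y)]
    norm_num
  calc ‖∫ y, F y * (ρ y : ℂ) ∂μ‖ₑ ^ 2
      ≤ (∫⁻ y, ‖F y * (ρ y : ℂ)‖ₑ ∂μ) ^ 2 := by
        gcongr
        exact enorm_integral_le_lintegral_enorm _
    _ ≤ ((∫⁻ y, ‖F y‖ₑ ^ 2 * ENNReal.ofReal (ω y) * ENNReal.ofReal (ρ y) ∂μ) ^ (1 / 2 : ℝ) *
          (∫⁻ y, ENNReal.ofReal (ρ y * (ω y)⁻¹) ∂μ) ^ (1 / 2 : ℝ)) ^ 2 := by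
        rw [lintegral_congr_ae hsplit]
        gcongr
        exact ENNReal.lintegral_mul_norm_pow_le (by fun_prop) (by fun_prop) (by norm_num)
          (by norm_num) (by norm_num)
    _ = _ := by
        rw [mul_pow, ← ENNReal.rpow_natCast, ← ENNReal.rpow_natCast, ← ENNReal.rpow_mul,
          ← ENNReal.rpow_mul]
        norm_num

variable (V) in
/-- This is Plancherel in the variable `cayley t`: the `k`-th coefficient integrates `F` against
`poissonWeight k`, which Cauchy–Schwarz bounds with a loss that is uniform in `k`. -/
lemma exists_lintegral_enorm_integral_cexp_sq_le [Nontrivial V] {ε : ℝ} (hε : 0 ≤ ε)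
    (hε1 : ε ≤ 1) :
    ∃ D : ℝ, 0 ≤ D ∧ ∀ F : V → ℂ, Integrable F →
      ∫⁻ t, ‖∫ y, F y * Complex.exp (-Real.pi ^ 2 * ‖y‖ ^ 2 / vertLine t)‖ₑ ^ 2 *
          ENNReal.ofReal (1 / ‖vertLine t‖ ^ 2) ≤
        ENNReal.ofReal D *
          ∫⁻ y, ‖F y‖ₑ ^ 2 * ENNReal.ofReal (‖y‖ ^ (Module.finrank ℝ V - 2 + ε)) := by
  set D : ℝ := Module.finrank ℝ V * (volume : Measure V).real (Metric.ball 0 1) *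
    (2 + 2 * (1 / Real.pi ^ 2))
  refine ⟨D, by positivity, fun F hF => ?_⟩
  set ω : V → ℝ := fun y => ‖y‖ ^ (Module.finrank ℝ V - 2 + ε) with hω
  have hω0 : ∀ᵐ y : V, 0 < ω y := by
    filter_upwards [compl_mem_ae_iff.2 (measure_singleton (0 : V))] with y hy
    exact Real.rpow_pos_of_pos (norm_pos_iff.2 hy) _
  have hFm := hF.aestronglyMeasurable
  calc ∫⁻ t, ‖∫ y, F y * Complex.exp (-Real.pi ^ 2 * ‖y‖ ^ 2 / vertLine t)‖ₑ ^ 2 *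
        ENNReal.ofReal (1 / ‖vertLine t‖ ^ 2)
      ≤ ∑' k, ‖(-1) ^ k * ∫ y, F y * (poissonWeight k ‖y‖ : ℂ)‖ₑ ^ 2 :=
        lintegral_enorm_sq_le_tsum_of_hasSum_cayley (hasSum_integral_mul_poissonWeight hF)
    _ ≤ ∑' k, ENNReal.ofReal D *
          ∫⁻ y, ‖F y‖ₑ ^ 2 * ENNReal.ofReal (ω y) * ENNReal.ofReal (poissonWeight k ‖y‖) := by
        gcongr with k
        rw [enorm_mul, enorm_pow, enorm_neg, enorm_one, one_pow, one_mul, mul_comm]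
        refine (enorm_integral_mul_sq_le hFm (by fun_prop) (by fun_prop)
          (fun y => poissonWeight_nonneg k ‖y‖) hω0).trans ?_
        gcongr
        simp only [hω, ← Real.rpow_neg (norm_nonneg _)]
        exact lintegral_poissonWeight_mul_norm_rpow_le hε hε1 k
    _ = ENNReal.ofReal D * ∫⁻ y, ‖F y‖ₑ ^ 2 * ENNReal.ofReal (ω y) := by
        rw [ENNReal.tsum_mul_left, ← lintegral_tsum fun k => by fun_prop]
        simp only [ENNReal.tsum_mul_left, tsum_ofReal_poissonWeight, mul_one]

end GaussianExtension

section DyadicBlock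

/-- The dyadic part of the line `Re b = 1` on which `2 ^ j ≤ ‖b‖ < 2 ^ (j + 1)`, parametrised by
`b = vertLine t`. -/
def dyadicBlock (j : ℕ) : Set ℝ := {t | (2 : ℝ) ^ j ≤ ‖vertLine t‖ ∧ ‖vertLine t‖ < 2 ^ (j + 1)}

lemma measurableSet_dyadicBlock (j : ℕ) : MeasurableSet (dyadicBlock j) :=
  (measurableSet_le measurable_const measurable_vertLine.norm).inter
    (measurableSet_lt measurable_vertLine.norm measurable_const)

lemma iUnion_dyadicBlock : ⋃ j, dyadicBlock j = univ :=
  eq_univ_of_forall fun t => mem_iUnion.2 (exists_nat_pow_near (one_le_norm_vertLine t) one_lt_two)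

lemma norm_vertLine_le_of_mem_dyadicBlock {j : ℕ} {t : ℝ} (ht : t ∈ dyadicBlock j) :
    ‖vertLine t‖ ≤ 2 * 2 ^ j := by
  rw [← pow_succ']
  exact ht.2.le

lemma volume_dyadicBlock_le (j : ℕ) : volume (dyadicBlock j) ≤ ENNReal.ofReal (4 * 2 ^ j) := by
  have hsub : dyadicBlock j ⊆ Icc (-(2 * 2 ^ j)) (2 * 2 ^ j) := fun t ht =>
    abs_le.1 ((abs_le_norm_vertLine t).trans (norm_vertLine_le_of_mem_dyadicBlock ht))
  refine (measure_mono hsub).trans_eq ?_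
  rw [Real.volume_Icc]
  ring_nf

end DyadicBlock

section SquareFunction

lemma exists_mul_exp_neg_rpow_le {κ s : ℝ} (hκ : 0 < κ) (hs : 0 < s) :
    ∃ C : ℝ, 0 ≤ C ∧ ∀ X : ℝ, 0 < X → X * Real.exp (-(κ * X ^ s)) ≤ C := by
  refine ⟨Real.exp (-(1 + Real.log (κ * s)) / s), by positivity, fun X hX => ?_⟩
  have hlog := Real.log_le_sub_one_of_pos (show 0 < κ * s * X ^ s by positivity)
  rw [Real.log_mul (by positivity) (by positivity), Real.log_rpow hX] at hlog
  nth_rewrite 1 [← Real.exp_log hX]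
  rw [← Real.exp_add, Real.exp_le_exp, le_div_iff₀ hs]
  nlinarith

lemma eLpNorm_two_sq {α E : Type*} [MeasurableSpace α] [TopologicalSpace E]
    [ContinuousENorm E] (f : α → E) (μ : Measure α) :
    eLpNorm f 2 μ ^ 2 = ∫⁻ x, ‖f x‖ₑ ^ 2 ∂μ := by
  simpa using eLpNorm_nnreal_pow_eq_lintegral (f := f) (μ := μ) two_ne_zero

variable {V : Type*} [NormedAddCommGroup V] [InnerProductSpace ℝ V] [FiniteDimensional ℝ V]
  [MeasurableSpace V] [BorelSpace V]

/-- The local square function of the multipliers `exp (-b ‖ξ‖²)` over a dyadic part of the line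
`Re b = 1`. -/
noncomputable def squareFn (j : ℕ) (f : V → ℂ) (x : V) : ℝ≥0∞ :=
  eLpNorm (fun t => heatOp (vertLine t) f x) 2 (volume.restrict (dyadicBlock j))

lemma squareFn_sq (j : ℕ) (f : V → ℂ) (x : V) :
    squareFn j f x ^ 2 = ∫⁻ t in dyadicBlock j, ‖heatOp (vertLine t) f x‖ₑ ^ 2 :=
  eLpNorm_two_sq _ _

lemma measurable_heatOp_vertLine {f : V → ℂ} (hf : AEStronglyMeasurable f volume) :
    Measurable fun q : V × ℝ => heatOp (vertLine q.2) f q.1 :=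
  measurable_heatOp (measurable_vertLine.comp measurable_snd) measurable_fst hf

lemma measurable_heatOp_vertLine_left {f : V → ℂ} (hf : AEStronglyMeasurable f volume) (x : V) :
    Measurable fun t => heatOp (vertLine t) f x :=
  measurable_heatOp measurable_vertLine measurable_const hf

lemma measurable_squareFn (j : ℕ) {f : V → ℂ} (hf : AEStronglyMeasurable f volume) :
    Measurable (squareFn j f) := by
  have hsqrt : squareFn j f = fun x =>
      (∫⁻ t in dyadicBlock j, ‖heatOp (vertLine t) f x‖ₑ ^ 2) ^ (1 / 2 : ℝ) := by
    ext x
    rw [← squareFn_sq, ← ENNReal.rpow_natCast, ← ENNReal.rpow_mul]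
    norm_num
  rw [hsqrt]
  exact (((measurable_heatOp_vertLine hf).enorm.pow_const 2).lintegral_prod_right').pow_const _

lemma squareFn_add_le (j : ℕ) {p q : ℝ≥0∞} (hp : 1 ≤ p) (hq : 1 ≤ q) {f g : V → ℂ}
    (hf : MemLp f p) (hg : MemLp g q) (x : V) :
    squareFn j (f + g) x ≤ squareFn j f x + squareFn j g x := by
  have hadd : (fun t => heatOp (vertLine t) (f + g) x) =
      (fun t => heatOp (vertLine t) f x) + fun t => heatOp (vertLine t) g x :=
    funext fun t => heatOp_add (vertLine_re_pos t) hp hq hf hg x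
  rw [squareFn, hadd]
  exact eLpNorm_add_le
    (measurable_heatOp_vertLine_left hf.aestronglyMeasurable x).aestronglyMeasurable
    (measurable_heatOp_vertLine_left hg.aestronglyMeasurable x).aestronglyMeasurable one_le_two

lemma eLpNorm_squareFn_two_le (j : ℕ) {f : V → ℂ} (hf : MemLp f 2) :
    eLpNorm (squareFn j f) 2 volume ≤
      ENNReal.ofReal ((4 * 2 ^ j) ^ (1 / 2 : ℝ)) * eLpNorm f 2 volume := by
  have hsq : eLpNorm (squareFn j f) 2 volume ^ 2 ≤
      (ENNReal.ofReal ((4 * 2 ^ j) ^ (1 / 2 : ℝ)) * eLpNorm f 2 volume) ^ 2 :=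
    calc eLpNorm (squareFn j f) 2 volume ^ 2
        = ∫⁻ t in dyadicBlock j, ∫⁻ x, ‖heatOp (vertLine t) f x‖ₑ ^ 2 := by
          simp only [eLpNorm_two_sq, enorm_eq_self, squareFn_sq]
          exact lintegral_lintegral_swap
            ((measurable_heatOp_vertLine hf.1).enorm.pow_const 2).aemeasurable
      _ ≤ ∫⁻ _ in dyadicBlock j, eLpNorm f 2 volume ^ 2 := by
          gcongr with t
          rw [← eLpNorm_two_sq]
          gcongr
          exact eLpNorm_heatOp_le (vertLine_re_pos t) hf
      _ ≤ ENNReal.ofReal (4 * 2 ^ j) * eLpNorm f 2 volume ^ 2 := by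
          rw [lintegral_const, Measure.restrict_apply_univ, mul_comm]
          gcongr
          exact volume_dyadicBlock_le j
      _ = _ := by
          rw [mul_pow, ← ENNReal.ofReal_pow (by positivity), ← Real.sqrt_eq_rpow,
            Real.sq_sqrt (by positivity)]
  exact (ENNReal.pow_le_pow_left_iff two_ne_zero).1 hsq

lemma lintegral_exp_neg_mul_sq_norm_sub {κ : ℝ} (hκ : 0 < κ) (x : V) :
    ∫⁻ y, ENNReal.ofReal (Real.exp (-κ * ‖x - y‖ ^ 2)) =
      ENNReal.ofReal ((Real.pi / κ) ^ (Module.finrank ℝ V / 2 : ℝ)) := by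
  rw [lintegral_sub_left_eq_self (fun y => ENNReal.ofReal (Real.exp (-κ * ‖y‖ ^ 2))) x,
    ← ofReal_integral_eq_lintegral_ofReal (integrable_exp_neg_mul_sq_norm hκ)
      (ae_of_all _ fun y => by positivity), GaussianFourier.integral_rexp_neg_mul_sq_norm hκ]

lemma enorm_heatOp_le_of_eqOn_ball_zero {b : ℂ} (hb : 0 < b.re) {f : V → ℂ} {x : V} {R : ℝ}
    (hR : 0 ≤ R) (hf : ∀ y ∈ Metric.ball x R, f y = 0) :
    ‖heatOp b f x‖ₑ ≤ ENNReal.ofReal ((2 * ‖b‖ / b.re) ^ (Module.finrank ℝ V / 2 : ℝ) *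
      Real.exp (-(Real.pi ^ 2 * b.re / (2 * ‖b‖ ^ 2) * R ^ 2))) * eLpNorm f ⊤ volume := by
  have hbn : 0 < ‖b‖ := hb.trans_le (Complex.re_le_norm b)
  set κ : ℝ := Real.pi ^ 2 * b.re / (2 * ‖b‖ ^ 2) with hκ
  have hκ0 : 0 < κ := by positivity
  set c : ℝ := (Real.pi / ‖b‖) ^ (Module.finrank ℝ V / 2 : ℝ) * Real.exp (-(κ * R ^ 2)) with hc
  have hmass : Real.pi / ‖b‖ * (Real.pi / κ) = 2 * ‖b‖ / b.re := by
    rw [hκ]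
    field_simp
  have hkernel : ∀ y, R ≤ ‖y‖ → ‖gaussKernel (V := V) b y‖ ≤ c * Real.exp (-κ * ‖y‖ ^ 2) := by
    intro y hy
    rw [norm_gaussKernel, hc, mul_assoc, ← Real.exp_add,
      show Real.pi ^ 2 * (b.re / ‖b‖ ^ 2) = κ + κ by rw [hκ]; ring]
    have hRy : κ * R ^ 2 ≤ κ * ‖y‖ ^ 2 := by gcongr
    gcongr
    linarith
  have hbound : ∀ᵐ y, ‖gaussKernel b (x - y) * f y‖ₑ ≤
      ENNReal.ofReal c * ENNReal.ofReal (Real.exp (-κ * ‖x - y‖ ^ 2)) * eLpNorm f ⊤ volume := by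
    filter_upwards [enorm_ae_le_eLpNormEssSup f volume] with y hy
    by_cases hyR : y ∈ Metric.ball x R
    · simp [hf y hyR]
    rw [Metric.mem_ball, dist_comm, dist_eq_norm, not_lt] at hyR
    rw [enorm_mul, ← ENNReal.ofReal_mul (by positivity), eLpNorm_exponent_top, ← ofReal_norm]
    gcongr
    exact hkernel _ hyR
  calc ‖heatOp b f x‖ₑ
      ≤ ∫⁻ y, ENNReal.ofReal c * ENNReal.ofReal (Real.exp (-κ * ‖x - y‖ ^ 2)) *
          eLpNorm f ⊤ volume :=
        (enorm_integral_le_lintegral_enorm _).trans (lintegral_mono_ae hbound)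
    _ = ENNReal.ofReal (c * (Real.pi / κ) ^ (Module.finrank ℝ V / 2 : ℝ)) *
          eLpNorm f ⊤ volume := by
        rw [lintegral_mul_const _ (by fun_prop), lintegral_const_mul _ (by fun_prop),
          lintegral_exp_neg_mul_sq_norm_sub hκ0, ← ENNReal.ofReal_mul (by positivity)]
    _ = _ := by
        rw [hc, mul_right_comm, ← Real.mul_rpow (by positivity) (by positivity), hmass]

lemma heatOp_eq_mul_integral (b : ℂ) (f : V → ℂ) (x : V) :
    heatOp b f x = (Real.pi / b) ^ (Module.finrank ℝ V / 2 : ℂ) *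
      ∫ y, f (x - y) * Complex.exp (-Real.pi ^ 2 * ‖y‖ ^ 2 / b) := by
  rw [heatOp, ← integral_sub_left_eq_self _ volume x, ← integral_const_mul]
  refine integral_congr_ae (ae_of_all _ fun y => ?_)
  simp only [sub_sub_cancel, gaussKernel]
  ring

lemma lintegral_enorm_sq_mul_norm_rpow_le {f : V → ℂ} {x : V} {R : ℝ}
    (hf : ∀ y ∉ Metric.ball x R, f y = 0) (s : ℝ) :
    ∫⁻ y, ‖f (x - y)‖ₑ ^ 2 * ENNReal.ofReal (‖y‖ ^ s) ≤
      eLpNorm f ⊤ volume ^ 2 * ∫⁻ y in Metric.ball (0 : V) R, ENNReal.ofReal (‖y‖ ^ s) := by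
  have hfx : ∀ᵐ y, ‖f (x - y)‖ₑ ≤ eLpNorm f ⊤ volume :=
    (quasiMeasurePreserving_sub_left volume x).ae
      (enorm_ae_le_eLpNormEssSup f volume)
  rw [← lintegral_const_mul _ (by fun_prop), ← lintegral_indicator Metric.isOpen_ball.measurableSet]
  refine lintegral_mono_ae ?_
  filter_upwards [hfx] with y hy
  by_cases hyR : y ∈ Metric.ball (0 : V) R
  · rw [indicator_of_mem hyR]
    gcongr
  · have hxy : x - y ∉ Metric.ball x R := by simpa using hyR
    simp [hf _ hxy]

lemma squareFn_le_of_eqOn_ball_zero (j : ℕ) {f : V → ℂ} {x : V} {R : ℝ} (hR : 0 ≤ R)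
    (hf : ∀ y ∈ Metric.ball x R, f y = 0) :
    squareFn j f x ≤ ENNReal.ofReal ((4 * 2 ^ j) ^ (Module.finrank ℝ V / 2 : ℝ) *
      Real.exp (-(Real.pi ^ 2 / (2 * (2 * 2 ^ j) ^ 2) * R ^ 2)) * (4 * 2 ^ j) ^ (1 / 2 : ℝ)) *
        eLpNorm f ⊤ volume := by
  set N : ℝ := 2 ^ j
  set c : ℝ := (4 * N) ^ (Module.finrank ℝ V / 2 : ℝ) *
    Real.exp (-(Real.pi ^ 2 / (2 * (2 * N) ^ 2) * R ^ 2)) with hc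
  have hpt : ∀ᵐ t ∂volume.restrict (dyadicBlock j),
      ‖heatOp (vertLine t) f x‖ₑ ≤ ENNReal.ofReal c * eLpNorm f ⊤ volume := by
    filter_upwards [ae_restrict_mem (measurableSet_dyadicBlock j)] with t ht
    have hbN : ‖vertLine t‖ ≤ 2 * N := norm_vertLine_le_of_mem_dyadicBlock ht
    have hb : 0 < ‖vertLine t‖ := norm_vertLine_pos t
    refine (enorm_heatOp_le_of_eqOn_ball_zero (vertLine_re_pos t) hR hf).trans ?_
    rw [vertLine_re, div_one, mul_one, hc]
    gcongr ENNReal.ofReal (?_ ^ _ * Real.exp (-(_ / (2 * ?_ ^ 2) * _))) * _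
    linarith
  calc squareFn j f x
      ≤ (ENNReal.ofReal c * eLpNorm f ⊤ volume) • volume (dyadicBlock j) ^ (1 / 2 : ℝ) := by
        simpa [squareFn] using eLpNorm_le_of_ae_enorm_bound (p := 2) hpt
    _ ≤ (ENNReal.ofReal c * eLpNorm f ⊤ volume) • ENNReal.ofReal (4 * N) ^ (1 / 2 : ℝ) := by
        gcongr
        exact volume_dyadicBlock_le j
    _ = _ := by
        rw [ENNReal.ofReal_rpow_of_nonneg (by positivity) (by norm_num), smul_eq_mul,
          mul_right_comm, ← ENNReal.ofReal_mul (by positivity)]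

lemma enorm_cpow_sq_le_of_mem_dyadicBlock (d : ℕ) {j : ℕ} {t : ℝ} (ht : t ∈ dyadicBlock j) :
    ‖(Real.pi / vertLine t : ℂ) ^ (d / 2 : ℂ)‖ₑ ^ 2 ≤
      ENNReal.ofReal (4 * Real.pi ^ d * (2 ^ j) ^ (2 - d : ℝ)) *
        ENNReal.ofReal (1 / ‖vertLine t‖ ^ 2) := by
  set N : ℝ := 2 ^ j
  have hN0 : 0 < N := by positivity
  have hb := norm_vertLine_pos t
  have hnorm : ‖(Real.pi / vertLine t : ℂ) ^ (d / 2 : ℂ)‖ ^ 2 = (Real.pi / ‖vertLine t‖) ^ d := by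
    rw [show (d / 2 : ℂ) = ((d / 2 : ℝ) : ℂ) by push_cast; rfl, Complex.norm_cpow_real, norm_div,
      Complex.norm_of_nonneg Real.pi_pos.le, ← Real.rpow_natCast, ← Real.rpow_mul (by positivity),
      ← Real.rpow_natCast]
    congr 1
    push_cast
    ring
  rw [← ofReal_norm, ← ENNReal.ofReal_pow (norm_nonneg _), ← ENNReal.ofReal_mul (by positivity),
    hnorm, mul_one_div]
  refine ENNReal.ofReal_le_ofReal ((le_div_iff₀ (by positivity)).2 ?_)
  calc (Real.pi / ‖vertLine t‖) ^ d * ‖vertLine t‖ ^ 2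
      ≤ (Real.pi / N) ^ d * (2 * N) ^ 2 := by
        gcongr
        · exact ht.1
        · exact norm_vertLine_le_of_mem_dyadicBlock ht
    _ = 4 * Real.pi ^ d * N ^ (2 - d : ℝ) := by
        rw [Real.rpow_sub hN0, Real.rpow_natCast, Real.rpow_two, div_pow]
        ring

variable (V) in
lemma exists_squareFn_sq_le_of_eqOn_compl_ball_zero [Nontrivial V] {ε : ℝ} (hε : 0 < ε)
    (hε1 : ε ≤ 1) :
    ∃ C : ℝ, 0 ≤ C ∧ ∀ (j : ℕ) (f : V → ℂ) (x : V) (R : ℝ), 0 ≤ R → MemLp f ⊤ →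
      (∀ y ∉ Metric.ball x R, f y = 0) → squareFn j f x ^ 2 ≤ ENNReal.ofReal (C *
        ((2 ^ j) ^ (2 - Module.finrank ℝ V : ℝ) * R ^ (2 * Module.finrank ℝ V - 2 + ε : ℝ))) *
          eLpNorm f ⊤ volume ^ 2 := by
  obtain ⟨D, hD, hlocal⟩ := exists_lintegral_enorm_integral_cexp_sq_le V hε.le hε1
  set d := Module.finrank ℝ V
  have hd1 : (1 : ℝ) ≤ d := by exact_mod_cast Module.finrank_pos (R := ℝ) (M := V)
  set D' : ℝ := d * (volume : Measure V).real (Metric.ball 0 1)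
  have hs : 0 < (d : ℝ) + (d - 2 + ε) := by linarith
  refine ⟨4 * Real.pi ^ d * D * D' / (d + (d - 2 + ε)), by positivity, fun j f x R hR hf hfR => ?_⟩
  set H : ℝ → ℂ := fun t =>
    ∫ y, f (x - y) * Complex.exp (-Real.pi ^ 2 * ‖y‖ ^ 2 / vertLine t)
  have hfi : Integrable f :=
    memLp_one_iff_integrable.1
      (hf.mono_exponent_of_measure_support_ne_top hfR measure_ball_lt_top.ne le_top)
  rw [squareFn_sq]
  calc ∫⁻ t in dyadicBlock j, ‖heatOp (vertLine t) f x‖ₑ ^ 2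
      ≤ ∫⁻ t in dyadicBlock j, ENNReal.ofReal (4 * Real.pi ^ d * (2 ^ j) ^ (2 - d : ℝ)) *
          (‖H t‖ₑ ^ 2 * ENNReal.ofReal (1 / ‖vertLine t‖ ^ 2)) := by
        refine setLIntegral_mono' (measurableSet_dyadicBlock j) fun t ht => ?_
        rw [heatOp_eq_mul_integral, enorm_mul, mul_pow, mul_left_comm, mul_comm]
        gcongr
        exact enorm_cpow_sq_le_of_mem_dyadicBlock d ht
    _ ≤ ENNReal.ofReal (4 * Real.pi ^ d * (2 ^ j) ^ (2 - d : ℝ)) *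
          (ENNReal.ofReal D * (eLpNorm f ⊤ volume ^ 2 *
            ENNReal.ofReal (D' * (R ^ (d + (d - 2 + ε) : ℝ) / (d + (d - 2 + ε)))))) := by
        rw [lintegral_const_mul' _ _ ENNReal.ofReal_ne_top]
        gcongr
        refine (setLIntegral_le_lintegral _ _).trans ((hlocal _ (hfi.comp_sub_left x)).trans ?_)
        gcongr
        refine (lintegral_enorm_sq_mul_norm_rpow_le hfR _).trans ?_
        gcongr
        exact lintegral_ball_norm_rpow_le hs hR
    _ = _ := by
        rw [mul_left_comm, mul_comm (eLpNorm f ⊤ volume ^ 2), ← mul_assoc, ← mul_assoc,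
          ← ENNReal.ofReal_mul (by positivity), ← ENNReal.ofReal_mul (by positivity)]
        ring_nf

variable (V) in
lemma exists_squareFn_le_of_eqOn_compl_ball_zero [Nontrivial V] {ε : ℝ} (hε : 0 < ε)
    (hε1 : ε ≤ 1) :
    ∃ C : ℝ, 0 ≤ C ∧ ∀ (j : ℕ) (f : V → ℂ) (x : V), MemLp f ⊤ →
      (∀ y ∉ Metric.ball x ((2 ^ j) ^ (1 + ε)), f y = 0) → squareFn j f x ≤
        ENNReal.ofReal (C * (2 ^ j) ^ (Module.finrank ℝ V / 2 + ε * Module.finrank ℝ V : ℝ)) *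
          eLpNorm f ⊤ volume := by
  obtain ⟨C, hC, hnear⟩ := exists_squareFn_sq_le_of_eqOn_compl_ball_zero V hε hε1
  refine ⟨√C, by positivity, fun j f x hf hfR => ?_⟩
  rw [← ENNReal.pow_le_pow_left_iff two_ne_zero]
  refine (hnear j f x _ (by positivity) hf hfR).trans ?_
  set N : ℝ := 2 ^ j
  set d : ℝ := (Module.finrank ℝ V : ℝ)
  have hN1 : 1 ≤ N := one_le_pow₀ one_le_two
  have hN0 : 0 ≤ N := by positivity
  rw [mul_pow, ← ENNReal.ofReal_pow (by positivity), mul_pow, Real.sq_sqrt hC]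
  gcongr
  rw [← Real.rpow_mul hN0, ← Real.rpow_add (by positivity), ← Real.rpow_mul_natCast hN0]
  refine Real.rpow_le_rpow_of_exponent_le hN1 ?_
  push_cast
  nlinarith

variable (V) in
/-- On the block `‖b‖ ≈ 2 ^ j` the kernel lives at scale `2 ^ j`, so that beyond the slightly larger
radius `(2 ^ j) ^ (1 + ε)` only a Gaussian tail remains. -/
lemma exists_squareFn_le_of_eqOn_ball_zero {ε : ℝ} (hε : 0 < ε) :
    ∃ C : ℝ, 0 ≤ C ∧ ∀ (j : ℕ) (f : V → ℂ) (x : V),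
      (∀ y ∈ Metric.ball x ((2 ^ j) ^ (1 + ε)), f y = 0) → squareFn j f x ≤
        ENNReal.ofReal (C * (2 ^ j) ^ (Module.finrank ℝ V / 2 : ℝ)) * eLpNorm f ⊤ volume := by
  obtain ⟨E, hE, hexp⟩ := exists_mul_exp_neg_rpow_le (κ := Real.pi ^ 2 / 8) (s := 2 * ε)
    (by positivity) (by positivity)
  set d : ℝ := (Module.finrank ℝ V : ℝ)
  refine ⟨4 ^ (d / 2) * 4 * E, by positivity, fun j f x hfR => ?_⟩
  refine (squareFn_le_of_eqOn_ball_zero j (by positivity) hfR).trans ?_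
  set N : ℝ := 2 ^ j
  have hN1 : 1 ≤ N := one_le_pow₀ one_le_two
  have hN0 : 0 < N := by positivity
  have hdecay : Real.pi ^ 2 / (2 * (2 * N) ^ 2) * (N ^ (1 + ε)) ^ 2 =
      Real.pi ^ 2 / 8 * N ^ (2 * ε) := by
    rw [← Real.rpow_mul_natCast hN0.le, show (1 + ε) * (2 : ℕ) = 2 + 2 * ε by push_cast; ring,
      Real.rpow_add hN0, Real.rpow_two]
    field_simp
    norm_num
  rw [hdecay, Real.mul_rpow (by norm_num) hN0.le]
  gcongr ENNReal.ofReal ?_ * _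
  calc 4 ^ (d / 2) * N ^ (d / 2) * Real.exp (-(Real.pi ^ 2 / 8 * N ^ (2 * ε))) *
        (4 * N) ^ (1 / 2 : ℝ)
      ≤ 4 ^ (d / 2) * N ^ (d / 2) * Real.exp (-(Real.pi ^ 2 / 8 * N ^ (2 * ε))) * (4 * N) := by
        gcongr
        exact Real.rpow_le_self_of_one_le (by linarith) (by norm_num)
    _ = 4 ^ (d / 2) * 4 * (N * Real.exp (-(Real.pi ^ 2 / 8 * N ^ (2 * ε)))) * N ^ (d / 2) := by
        ring
    _ ≤ _ := by
        gcongr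
        exact hexp N hN0

variable (V) in
lemma exists_squareFn_le [Nontrivial V] {η : ℝ} (hη : 0 < η) :
    ∃ C : ℝ, 0 < C ∧ ∀ (j : ℕ) (f : V → ℂ) (x : V), MemLp f ⊤ → squareFn j f x ≤
      ENNReal.ofReal (C * (2 ^ j) ^ (Module.finrank ℝ V / 2 + η : ℝ)) * eLpNorm f ⊤ volume := by
  have hd : (0 : ℝ) < Module.finrank ℝ V := by exact_mod_cast Module.finrank_pos
  set d : ℝ := (Module.finrank ℝ V : ℝ)
  set ε : ℝ := min 1 (η / d)
  have hε : 0 < ε := by positivity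
  have hεη : ε * d ≤ η := (le_div_iff₀ hd).1 (min_le_right _ _)
  obtain ⟨C₁, hC₁, hnear⟩ := exists_squareFn_le_of_eqOn_compl_ball_zero V hε (min_le_left _ _)
  obtain ⟨C₂, hC₂, hfar⟩ := exists_squareFn_le_of_eqOn_ball_zero V hε
  refine ⟨C₁ + C₂ + 1, by positivity, fun j f x hf => ?_⟩
  set N : ℝ := 2 ^ j
  have hN1 : 1 ≤ N := one_le_pow₀ one_le_two
  set B := Metric.ball x (N ^ (1 + ε))
  have hB : MeasurableSet B := measurableSet_ball
  calc squareFn j f x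
      = squareFn j (B.indicator f + Bᶜ.indicator f) x := by rw [indicator_self_add_compl]
    _ ≤ squareFn j (B.indicator f) x + squareFn j (Bᶜ.indicator f) x :=
        squareFn_add_le j le_top le_top (hf.indicator hB) (hf.indicator hB.compl) x
    _ ≤ ENNReal.ofReal (C₁ * N ^ (d / 2 + ε * d)) * eLpNorm (B.indicator f) ⊤ volume +
          ENNReal.ofReal (C₂ * N ^ (d / 2)) * eLpNorm (Bᶜ.indicator f) ⊤ volume := by
        gcongr
        · exact hnear j _ x (hf.indicator hB) fun y hy => indicator_of_notMem hy f
        · exact hfar j _ x fun y hy => indicator_of_notMem (not_not.2 hy) f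
    _ ≤ ENNReal.ofReal (C₁ * N ^ (d / 2 + η)) * eLpNorm f ⊤ volume +
          ENNReal.ofReal (C₂ * N ^ (d / 2 + η)) * eLpNorm f ⊤ volume := by
        gcongr
        · exact eLpNorm_indicator_le f
        · linarith
        · exact eLpNorm_indicator_le f
    _ ≤ _ := by
        rw [← add_mul, ← ENNReal.ofReal_add (by positivity) (by positivity), ← add_mul]
        gcongr ENNReal.ofReal (?_ * _) * _
        linarith

end SquareFunction

section SquareFunctionLp

variable {V : Type*} [NormedAddCommGroup V] [InnerProductSpace ℝ V] [FiniteDimensional ℝ V]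
  [MeasurableSpace V] [BorelSpace V]

lemma isSubadditiveOfStrongType_squareFn (j : ℕ) {B : ℝ}
    (hB : ∀ (f : V → ℂ) (x : V), MemLp f ⊤ →
      squareFn j f x ≤ ENNReal.ofReal B * eLpNorm f ⊤ volume) :
    IsSubadditiveOfStrongType (squareFn j : (V → ℂ) → V → ℝ≥0∞) 2 ((4 * 2 ^ j) ^ (1 / 2 : ℝ)) B
      volume volume where
  add_le _ _ hu hv := .of_forall fun x => squareFn_add_le j one_le_two le_top hu hv x
  aemeasurable _ hu := (measurable_squareFn j hu.aestronglyMeasurable).aemeasurable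
  eLpNorm_le _ hu := eLpNorm_squareFn_two_le j hu
  eLpNorm_top_le v hv := eLpNormEssSup_le_of_ae_enorm_bound (.of_forall fun x => hB v x hv)

lemma rpow_mul_rpow_le_of_interpolation {d η p N C : ℝ} (hη : 0 ≤ η) (hp : 0 < p) (hN : 1 ≤ N)
    (hC : 0 ≤ C) :
    ((4 * N) ^ (1 / 2 : ℝ)) ^ (2 / p) * (C * N ^ (d / 2 + η)) ^ (1 - 2 / p) ≤
      4 ^ (1 / p) * C ^ (1 - 2 / p) * N ^ (d / 2 - (d - 1) * p⁻¹ + η) := by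
  have hN0 : 0 < N := by linarith
  have hexp : 1 / 2 * (2 / p) + (d / 2 + η) * (1 - 2 / p) =
      d / 2 - (d - 1) * p⁻¹ + η - 2 * η / p := by
    field_simp
    ring
  calc ((4 * N) ^ (1 / 2 : ℝ)) ^ (2 / p) * (C * N ^ (d / 2 + η)) ^ (1 - 2 / p)
      = 4 ^ (1 / p) * C ^ (1 - 2 / p) *
          (N ^ (1 / 2 * (2 / p)) * N ^ ((d / 2 + η) * (1 - 2 / p))) := by
        rw [Real.mul_rpow (by norm_num) hN0.le, Real.mul_rpow (by positivity) (by positivity),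
          Real.mul_rpow hC (by positivity), ← Real.rpow_mul (by norm_num), ← Real.rpow_mul hN0.le,
          ← Real.rpow_mul hN0.le, show 1 / 2 * (2 / p) = 1 / p by field_simp]
        ring
    _ ≤ 4 ^ (1 / p) * C ^ (1 - 2 / p) * N ^ (d / 2 - (d - 1) * p⁻¹ + η) := by
        rw [← Real.rpow_add hN0, hexp]
        gcongr
        have : 0 ≤ 2 * η / p := by positivity
        linarith

variable (V) in
lemma exists_eLpNorm_squareFn_le_of_lt [Nontrivial V] {p : ℝ≥0∞} (hp : 2 < p) (hp' : p ≠ ⊤)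
    {η : ℝ} (hη : 0 < η) :
    ∃ C : ℝ, 0 < C ∧ ∀ (j : ℕ) (f : V → ℂ), MemLp f p → eLpNorm (squareFn j f) p volume ≤
      ENNReal.ofReal (C * (2 ^ j) ^
        (Module.finrank ℝ V / 2 - (Module.finrank ℝ V - 1) * (p⁻¹).toReal + η : ℝ)) *
        eLpNorm f p volume := by
  obtain ⟨C, hC, hbound⟩ := exists_squareFn_le V hη
  have hp2 : 2 < p.toReal := by
    rwa [← ENNReal.toReal_ofNat, ENNReal.toReal_lt_toReal ENNReal.ofNat_ne_top hp']
  have : 0 < p.toReal - 2 := by linarith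
  set K : ℝ := (p.toReal * 2 ^ p.toReal / (p.toReal - 2)) ^ (1 / p.toReal)
  have : 0 < K := by positivity
  refine ⟨K * (4 ^ (1 / p.toReal) * C ^ (1 - 2 / p.toReal)), by positivity, fun j f hf => ?_⟩
  have hT := isSubadditiveOfStrongType_squareFn j fun f x hf => hbound j f x hf
  refine (hT.eLpNorm_le_of_lt (by positivity) (by positivity)
    (measurable_squareFn j hf.aestronglyMeasurable).aemeasurable hf two_ne_zero hp hp').trans ?_
  rw [ENNReal.toReal_ofNat, ENNReal.toReal_inv, mul_assoc, mul_assoc K]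
  gcongr ENNReal.ofReal (_ * ?_) * _
  exact rpow_mul_rpow_le_of_interpolation hη.le (by linarith) (one_le_pow₀ one_le_two) hC.le

variable (V) in
lemma exists_eLpNorm_squareFn_le [Nontrivial V] {p : ℝ≥0∞} (hp : 2 ≤ p) {η : ℝ} (hη : 0 < η) :
    ∃ C : ℝ, 0 < C ∧ ∀ (j : ℕ) (f : V → ℂ), MemLp f p → eLpNorm (squareFn j f) p volume ≤
      ENNReal.ofReal (C * (2 ^ j) ^
        (Module.finrank ℝ V / 2 - (Module.finrank ℝ V - 1) * (p⁻¹).toReal + η : ℝ)) *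
        eLpNorm f p volume := by
  rcases hp.eq_or_lt with rfl | hp2
  · refine ⟨2, two_pos, fun j f hf => (eLpNorm_squareFn_two_le j hf).trans ?_⟩
    have h4 : (4 : ℝ) ^ (1 / 2 : ℝ) = 2 := by
      rw [← Real.sqrt_eq_rpow, show (4 : ℝ) = 2 ^ 2 by norm_num, Real.sqrt_sq two_pos.le]
    rw [Real.mul_rpow (by norm_num) (by positivity), h4, ENNReal.toReal_inv, ENNReal.toReal_ofNat]
    gcongr
    · exact one_le_pow₀ one_le_two
    · linarith
  · rcases eq_or_ne p ⊤ with rfl | hp'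
    · obtain ⟨C, hC, hbound⟩ := exists_squareFn_le V hη
      refine ⟨C, hC, fun j f hf => ?_⟩
      simpa using (isSubadditiveOfStrongType_squareFn j
        fun f x hf => hbound j f x hf).eLpNorm_top_le f hf
    · exact exists_eLpNorm_squareFn_le_of_lt V hp2 hp' hη

end SquareFunctionLp

section BromwichInversion

lemma eqOn_re_pos_of_eq_ofReal {f g : ℂ → ℂ} (hf : AnalyticOnNhd ℂ f {z | 0 < z.re})
    (hg : AnalyticOnNhd ℂ g {z | 0 < z.re}) (hfg : ∀ r : ℝ, 0 < r → f r = g r) :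
    EqOn f g {z | 0 < z.re} := by
  have htend : Tendsto (fun r : ℝ => (r : ℂ)) (𝓝[≠] 1) (𝓝[≠] 1) :=
    Complex.continuous_ofReal.continuousAt.continuousWithinAt.tendsto_nhdsWithin
      fun r hr => by simpa using hr
  have hfreq : ∃ᶠ r : ℝ in 𝓝[≠] 1, f r = g r :=
    (((eventually_gt_nhds one_pos).filter_mono nhdsWithin_le_nhds).mono hfg).frequently
  exact hf.eqOn_of_preconnected_of_frequently_eq hg (convex_halfSpace_re_gt 0).isPreconnected
    (by simp) (htend.frequently hfreq)

lemma integral_rpow_mul_cexp_neg_mul_Ioi {a : ℝ} (ha : 0 < a) {b : ℂ} (hb : 0 < b.re) :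
    ∫ v in Ioi (0 : ℝ), (v ^ (a - 1) : ℝ) * Complex.exp (-b * v) =
      Real.Gamma a * b ^ (-a : ℂ) := by
  let μ : Measure ℝ := (volume.restrict (Ioi 0)).withDensity fun v => ENNReal.ofReal (v ^ (a - 1))
  have hdens : Measurable fun v : ℝ => ENNReal.ofReal (v ^ (a - 1)) := by fun_prop
  have hμ {E : Type} [NormedAddCommGroup E] [NormedSpace ℝ E] (g : ℝ → E) :
      ∫ v, g v ∂μ = ∫ v in Ioi 0, v ^ (a - 1) • g v := by
    rw [integral_withDensity_eq_integral_toReal_smul hdens (.of_forall fun _ => by simp)]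
    refine setIntegral_congr_fun measurableSet_Ioi fun v (hv : 0 < v) => ?_
    simp only [ENNReal.toReal_ofReal (Real.rpow_nonneg hv.le _)]
  have hmgf {r : ℝ} (hr : 0 < r) :
      ProbabilityTheory.mgf Neg.neg μ r = (1 / r) ^ a * Real.Gamma a := by
    simp_rw [ProbabilityTheory.mgf, hμ, smul_eq_mul, mul_neg,
      Real.integral_rpow_mul_exp_neg_mul_Ioi ha hr]
  have hsub : Ioi 0 ⊆ ProbabilityTheory.integrableExpSet Neg.neg μ := fun r (hr : 0 < r) =>
    not_imp_comm.1 integral_undef <| (hmgf hr).trans_ne <|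
      mul_ne_zero (by positivity) (Real.Gamma_pos_of_pos ha).ne'
  have hanalytic : AnalyticOnNhd ℂ (ProbabilityTheory.complexMGF Neg.neg μ) {z | 0 < z.re} :=
    ProbabilityTheory.analyticOnNhd_complexMGF.mono fun z hz => interior_maximal hsub isOpen_Ioi hz
  have hcpow : AnalyticOnNhd ℂ (fun z : ℂ => Real.Gamma a * z ^ (-a : ℂ)) {z | 0 < z.re} :=
    fun z hz => analyticAt_const.mul (analyticAt_id.cpow analyticAt_const (Or.inl hz))
  have hident := eqOn_re_pos_of_eq_ofReal hanalytic hcpow fun r hr => by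
    rw [ProbabilityTheory.complexMGF_ofReal, hmgf hr, one_div, Real.inv_rpow hr.le,
      ← Real.rpow_neg hr.le, mul_comm, Complex.ofReal_mul, Complex.ofReal_cpow hr.le,
      Complex.ofReal_neg]
  simpa [ProbabilityTheory.complexMGF, hμ] using hident hb

/-- The function `v₊ ^ δ e ^ {-v}` on the line. Its Fourier transform is `Γ(δ + 1) b ^ {-(δ + 1)}`
restricted to the line `Re b = 1`. -/
noncomputable def gammaFn (δ v : ℝ) : ℂ := ((max v 0) ^ δ * Real.exp (-v) : ℝ)

variable {δ : ℝ}

lemma gammaFn_of_nonpos (hδ : 0 < δ) {v : ℝ} (hv : v ≤ 0) : gammaFn δ v = 0 := by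
  simp [gammaFn, max_eq_right hv, Real.zero_rpow hδ.ne']

lemma continuous_gammaFn (hδ : 0 < δ) : Continuous (gammaFn δ) :=
  Complex.continuous_ofReal.comp <|
    ((continuous_id.max continuous_const).rpow_const fun _ => Or.inr hδ.le).mul (by fun_prop)

lemma integrable_gammaFn (hδ : 0 < δ) : Integrable (gammaFn δ) := by
  have hpos : IntegrableOn (gammaFn δ) (Ioi 0) := by
    refine IntegrableOn.congr_fun (Real.GammaIntegral_convergent (by linarith : 0 < δ + 1)).ofReal
      (fun v (hv : 0 < v) => ?_) measurableSet_Ioi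
    simp [gammaFn, max_eq_left hv.le, mul_comm]
  exact hpos.integrable_of_forall_notMem_eq_zero fun v hv => gammaFn_of_nonpos hδ (not_lt.1 hv)

lemma fourier_gammaFn (hδ : 0 < δ) (t : ℝ) :
    𝓕 (gammaFn δ) t = Real.Gamma (δ + 1) * vertLine t ^ ((-(δ + 1) : ℝ) : ℂ) := by
  rw [Complex.ofReal_neg,
    ← integral_rpow_mul_cexp_neg_mul_Ioi (by linarith : 0 < δ + 1) (vertLine_re_pos t),
    Real.fourier_eq', ← setIntegral_eq_integral_of_forall_compl_eq_zero (s := Ioi 0)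
      fun v hv => by rw [gammaFn_of_nonpos hδ (not_lt.1 hv), smul_zero]]
  refine setIntegral_congr_fun measurableSet_Ioi fun v (hv : 0 < v) => ?_
  have hexp : Complex.exp (((-2 * Real.pi * (t * v) : ℝ) : ℂ) * Complex.I) * Complex.exp (-v) =
      Complex.exp (-vertLine t * v) := by
    rw [← Complex.exp_add, vertLine]
    push_cast
    ring_nf
  simp only [gammaFn, max_eq_left hv.le, add_sub_cancel_right, smul_eq_mul, ← hexp,
    RCLike.inner_apply, conj_trivial]
  push_cast
  ring

/-- The density, on the line `Re b = 1`, of Bromwich's inversion formula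
`(1 - s)₊ ^ δ = Γ(δ + 1) / (2πi) ∫ e ^ b b ^ {-(δ + 1)} e ^ {-b s} db`. -/
noncomputable def bromwichDensity (δ t : ℝ) : ℂ :=
  Real.Gamma (δ + 1) * Complex.exp (vertLine t) * vertLine t ^ ((-(δ + 1) : ℝ) : ℂ)

lemma norm_bromwichDensity (hδ : 0 < δ) (t : ℝ) :
    ‖bromwichDensity δ t‖ = Real.Gamma (δ + 1) * Real.exp 1 * ‖vertLine t‖ ^ (-(δ + 1)) := by
  rw [bromwichDensity, norm_mul, norm_mul, Complex.norm_cpow_real, Complex.norm_exp, vertLine_re,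
    Complex.norm_of_nonneg (Real.Gamma_pos_of_pos (by linarith)).le]

lemma continuous_vertLine_cpow (c : ℂ) : Continuous fun t => vertLine t ^ c :=
  continuous_vertLine.cpow continuous_const fun t => Or.inl (vertLine_re_pos t)

lemma continuous_bromwichDensity : Continuous (bromwichDensity δ) :=
  (continuous_const.mul continuous_vertLine.cexp).mul (continuous_vertLine_cpow _)

lemma integrable_norm_vertLine_rpow (hδ : 0 < δ) :
    Integrable fun t => ‖vertLine t‖ ^ (-(δ + 1)) := by
  refine ((integrable_rpow_neg_one_add_norm_sq (E := ℝ) (μ := volume) (r := δ + 1)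
    (by simpa using hδ)).comp_mul_left' (R := 2 * Real.pi) (by positivity)).congr
    (.of_forall fun t => ?_)
  simp only [Real.norm_eq_abs, sq_abs]
  rw [← norm_vertLine_sq, ← Real.rpow_natCast_mul (norm_nonneg _)]
  congr 1
  push_cast
  ring

lemma integrable_bromwichDensity (hδ : 0 < δ) : Integrable (bromwichDensity δ) :=
  ((integrable_norm_vertLine_rpow hδ).const_mul _).mono'
    continuous_bromwichDensity.aestronglyMeasurable
    (.of_forall fun t => (norm_bromwichDensity hδ t).le)

lemma integral_bromwichDensity_mul_cexp (hδ : 0 < δ) (s : ℝ) :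
    ∫ t, bromwichDensity δ t * Complex.exp (-vertLine t * s) = ((max (1 - s) 0) ^ δ : ℝ) := by
  have hF : Integrable (𝓕 (gammaFn δ)) := by
    simp_rw [funext (fourier_gammaFn hδ)]
    refine (((integrable_norm_vertLine_rpow hδ).congr (.of_forall fun t => ?_)).mono'
      (continuous_vertLine_cpow _).aestronglyMeasurable (.of_forall fun t => le_rfl)).const_mul _
    exact (Complex.norm_cpow_real _ _).symm
  have hinv := congrFun
    ((continuous_gammaFn hδ).fourierInv_fourier_eq (integrable_gammaFn hδ) hF) (1 - s)
  have hgamma : ((max (1 - s) 0) ^ δ : ℝ) = Complex.exp (1 - s) * gammaFn δ (1 - s) := by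
    rw [gammaFn]
    push_cast
    rw [mul_left_comm, ← Complex.exp_add]
    simp
  rw [hgamma, ← hinv, Real.fourierInv_eq', ← integral_const_mul]
  refine integral_congr_ae (.of_forall fun t => ?_)
  have hexp : Complex.exp (vertLine t) * Complex.exp (-vertLine t * s) = Complex.exp (1 - s) *
      Complex.exp (((2 * Real.pi * inner ℝ t (1 - s) : ℝ) : ℂ) * Complex.I) := by
    rw [← Complex.exp_add, ← Complex.exp_add, vertLine, RCLike.inner_apply, conj_trivial]
    push_cast
    ring_nf
  simp only [bromwichDensity, fourier_gammaFn hδ, smul_eq_mul]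
  linear_combination Real.Gamma (δ + 1) * vertLine t ^ ((-(δ + 1) : ℝ) : ℂ) * hexp

end BromwichInversion

section BilinearLp

variable {α β γ 𝕜 E F G : Type*} [MeasurableSpace α] [MeasurableSpace β] [MeasurableSpace γ]
  [NormedField 𝕜] [NormedAddCommGroup E] [NormedSpace 𝕜 E] [NormedAddCommGroup F]
  [NormedSpace 𝕜 F] [NormedAddCommGroup G] [NormedSpace 𝕜 G]

variable (𝕜) in
/-- The operator `T` on pairs of functions is, up to null sets, bilinear on `L^p × L^q`, and it is
of strong type `(p, q; r)` with constant `C`. -/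
structure IsBilinearOfStrongType (T : (α → E) → (β → F) → γ → G) (p q r : ℝ≥0∞) (C : ℝ)
    (μ : Measure α) (ν : Measure β) (ρ : Measure γ) : Prop where
  congr_ae : ∀ {f f' g g'}, f =ᵐ[μ] f' → g =ᵐ[ν] g' → T f g =ᵐ[ρ] T f' g'
  add_left : ∀ {f₁ f₂ g}, MemLp f₁ p μ → MemLp f₂ p μ → MemLp g q ν →
    T (f₁ + f₂) g =ᵐ[ρ] T f₁ g + T f₂ g
  add_right : ∀ {f g₁ g₂}, MemLp f p μ → MemLp g₁ q ν → MemLp g₂ q ν →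
    T f (g₁ + g₂) =ᵐ[ρ] T f g₁ + T f g₂
  smul_left : ∀ (c : 𝕜) {f g}, MemLp f p μ → MemLp g q ν → T (c • f) g =ᵐ[ρ] c • T f g
  smul_right : ∀ (c : 𝕜) {f g}, MemLp f p μ → MemLp g q ν → T f (c • g) =ᵐ[ρ] c • T f g
  aestronglyMeasurable : ∀ {f g}, MemLp f p μ → MemLp g q ν → AEStronglyMeasurable (T f g) ρ
  eLpNorm_le : ∀ {f g}, MemLp f p μ → MemLp g q ν →
    eLpNorm (T f g) r ρ ≤ ENNReal.ofReal C * (eLpNorm f p μ * eLpNorm g q ν)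

namespace IsBilinearOfStrongType

variable {T : (α → E) → (β → F) → γ → G} {p q r : ℝ≥0∞} {C : ℝ} {μ : Measure α} {ν : Measure β}
  {ρ : Measure γ} {f : α → E} {g : β → F}

lemma memLp (hT : IsBilinearOfStrongType 𝕜 T p q r C μ ν ρ) (hf : MemLp f p μ)
    (hg : MemLp g q ν) : MemLp (T f g) r ρ :=
  ⟨hT.aestronglyMeasurable hf hg, (hT.eLpNorm_le hf hg).trans_lt <|
    ENNReal.mul_lt_top ENNReal.ofReal_lt_top (ENNReal.mul_lt_top hf.2 hg.2)⟩

lemma exists_linearMap_Lp (hT : IsBilinearOfStrongType 𝕜 T p q r C μ ν ρ) (hC : 0 ≤ C) :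
    ∃ B : Lp E p μ →ₗ[𝕜] Lp F q ν →ₗ[𝕜] Lp G r ρ,
      (∀ f g, ‖B f g‖ ≤ C * ‖f‖ * ‖g‖) ∧ ∀ f g, (B f g : γ → G) =ᵐ[ρ] T f g := by
  have hmem (f : Lp E p μ) (g : Lp F q ν) := hT.memLp (Lp.memLp f) (Lp.memLp g)
  refine ⟨LinearMap.mk₂ 𝕜 (fun f g => (hmem f g).toLp _) (fun f₁ f₂ g => ?_) (fun c f g => ?_)
    (fun f g₁ g₂ => ?_) (fun c f g => ?_), fun f g => ?_, fun f g => (hmem f g).coeFn_toLp⟩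
  · rw [← MemLp.toLp_add, MemLp.toLp_eq_toLp_iff]
    exact (hT.congr_ae (Lp.coeFn_add f₁ f₂) .rfl).trans
      (hT.add_left (Lp.memLp f₁) (Lp.memLp f₂) (Lp.memLp g))
  · rw [← MemLp.toLp_const_smul, MemLp.toLp_eq_toLp_iff]
    exact (hT.congr_ae (Lp.coeFn_smul c f) .rfl).trans
      (hT.smul_left c (Lp.memLp f) (Lp.memLp g))
  · rw [← MemLp.toLp_add, MemLp.toLp_eq_toLp_iff]
    exact (hT.congr_ae .rfl (Lp.coeFn_add g₁ g₂)).trans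
      (hT.add_right (Lp.memLp f) (Lp.memLp g₁) (Lp.memLp g₂))
  · rw [← MemLp.toLp_const_smul, MemLp.toLp_eq_toLp_iff]
    exact (hT.congr_ae .rfl (Lp.coeFn_smul c g)).trans
      (hT.smul_right c (Lp.memLp f) (Lp.memLp g))
  · have hfin := ENNReal.mul_ne_top (ENNReal.ofReal_ne_top (r := C))
      (ENNReal.mul_ne_top (Lp.memLp f).2.ne (Lp.memLp g).2.ne)
    simpa only [LinearMap.mk₂_apply, Lp.norm_toLp, ENNReal.toReal_mul, ENNReal.toReal_ofReal hC,
      ← Lp.norm_def, ← mul_assoc] using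
      ENNReal.toReal_mono hfin (hT.eLpNorm_le (Lp.memLp f) (Lp.memLp g))

end IsBilinearOfStrongType

end BilinearLp

section BromwichBilin

variable {V : Type*} [NormedAddCommGroup V] [InnerProductSpace ℝ V] [FiniteDimensional ℝ V]
  [MeasurableSpace V] [BorelSpace V] {δ : ℝ} {f g : V → ℂ}

/-- The superposition of products of Gaussian operators which extends the bilinear Bochner-Riesz
operator of order `δ` from Schwartz functions to `L^p` functions. -/
noncomputable def bromwichBilin (δ : ℝ) (f g : V → ℂ) (x : V) : ℂ :=
  ∫ t, bromwichDensity δ t * (heatOp (vertLine t) f x * heatOp (vertLine t) g x)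

/-- The integral of the absolute values in the definition of `bromwichBilin`. -/
noncomputable def bromwichBilinAbs (δ : ℝ) (f g : V → ℂ) (x : V) : ℝ≥0∞ :=
  ∫⁻ t, ‖bromwichDensity δ t * (heatOp (vertLine t) f x * heatOp (vertLine t) g x)‖ₑ

lemma bromwichBilin_comm (δ : ℝ) (f g : V → ℂ) : bromwichBilin δ f g = bromwichBilin δ g f := by
  ext x
  simp only [bromwichBilin, mul_comm (heatOp _ f x)]

lemma bromwichBilinAbs_comm (δ : ℝ) (f g : V → ℂ) :
    bromwichBilinAbs δ f g = bromwichBilinAbs δ g f := by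
  ext x
  simp only [bromwichBilinAbs, mul_comm (heatOp _ f x)]

lemma bromwichBilin_smul_left (c : ℂ) (f g : V → ℂ) :
    bromwichBilin δ (c • f) g = c • bromwichBilin δ f g := by
  ext x
  simp only [bromwichBilin, heatOp_smul, Pi.smul_apply, smul_eq_mul, ← integral_const_mul,
    mul_assoc, mul_left_comm c]

lemma bromwichBilin_congr_ae (δ : ℝ) {f f' g g' : V → ℂ} (hf : f =ᵐ[volume] f')
    (hg : g =ᵐ[volume] g') : bromwichBilin δ f g = bromwichBilin δ f' g' := by
  ext x
  simp only [bromwichBilin, heatOp_congr_ae _ hf, heatOp_congr_ae _ hg]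

lemma measurable_bromwichBilin_integrand (hf : AEStronglyMeasurable f volume)
    (hg : AEStronglyMeasurable g volume) : Measurable fun q : V × ℝ =>
      bromwichDensity δ q.2 * (heatOp (vertLine q.2) f q.1 * heatOp (vertLine q.2) g q.1) :=
  (continuous_bromwichDensity.measurable.comp measurable_snd).mul
    ((measurable_heatOp_vertLine hf).mul (measurable_heatOp_vertLine hg))

lemma measurable_bromwichBilinAbs (hf : AEStronglyMeasurable f volume)
    (hg : AEStronglyMeasurable g volume) : Measurable (bromwichBilinAbs δ f g) :=
  (measurable_bromwichBilin_integrand hf hg).enorm.lintegral_prod_right'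

lemma stronglyMeasurable_bromwichBilin (hf : AEStronglyMeasurable f volume)
    (hg : AEStronglyMeasurable g volume) : StronglyMeasurable (bromwichBilin δ f g) :=
  (measurable_bromwichBilin_integrand hf hg).stronglyMeasurable.integral_prod_right' (ν := volume)

lemma ae_integrable_of_eLpNorm_bromwichBilinAbs_ne_top {r : ℝ≥0∞} (hr : r ≠ 0)
    (hf : AEStronglyMeasurable f volume) (hg : AEStronglyMeasurable g volume)
    (hfin : eLpNorm (bromwichBilinAbs δ f g) r volume ≠ ⊤) :
    ∀ᵐ x, Integrable fun t =>
      bromwichDensity δ t * (heatOp (vertLine t) f x * heatOp (vertLine t) g x) := by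
  filter_upwards [ae_lt_top_of_eLpNorm_ne_top hr (measurable_bromwichBilinAbs hf hg).aemeasurable
    hfin] with x hx
  exact ⟨((measurable_bromwichBilin_integrand hf hg).comp
    measurable_prodMk_left).aestronglyMeasurable, hx⟩

lemma lintegral_dyadicBlock_heatOp_mul_heatOp_le (j : ℕ) (hf : AEStronglyMeasurable f volume)
    (hg : AEStronglyMeasurable g volume) (x : V) :
    ∫⁻ t in dyadicBlock j, ‖heatOp (vertLine t) f x * heatOp (vertLine t) g x‖ₑ ≤
      squareFn j f x * squareFn j g x := by
  have hcauchySchwarz := eLpNorm_smul_le_mul_eLpNorm (p := 2) (q := 2) (r := 1)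
    (μ := volume.restrict (dyadicBlock j))
    (measurable_heatOp_vertLine_left hg x).aestronglyMeasurable
    (measurable_heatOp_vertLine_left hf x).aestronglyMeasurable
  rwa [eLpNorm_one_eq_lintegral_enorm] at hcauchySchwarz

lemma bromwichBilinAbs_le_tsum (hδ : 0 < δ) (hf : AEStronglyMeasurable f volume)
    (hg : AEStronglyMeasurable g volume) (x : V) :
    bromwichBilinAbs δ f g x ≤ ∑' j : ℕ,
      ENNReal.ofReal (Real.Gamma (δ + 1) * Real.exp 1 * (2 ^ j) ^ (-(δ + 1))) *
        (squareFn j f x * squareFn j g x) := by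
  rw [bromwichBilinAbs, ← setLIntegral_univ, ← iUnion_dyadicBlock]
  refine (lintegral_iUnion_le _ _).trans (ENNReal.tsum_le_tsum fun j => ?_)
  refine le_trans ?_ (mul_le_mul_right (lintegral_dyadicBlock_heatOp_mul_heatOp_le j hf hg x) _)
  rw [← lintegral_const_mul' _ _ ENNReal.ofReal_ne_top]
  refine setLIntegral_mono' (measurableSet_dyadicBlock j) fun t ht => ?_
  have := (Real.Gamma_pos_of_pos (by linarith : 0 < δ + 1)).le
  rw [enorm_mul, ← ofReal_norm (bromwichDensity δ t), norm_bromwichDensity hδ]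
  gcongr ENNReal.ofReal (_ * ?_) * _
  exact Real.rpow_le_rpow_of_nonpos (by positivity) ht.1 (by linarith)

end BromwichBilin

section BilinearBounds

lemma one_le_of_holderTriple {p q r : ℝ≥0∞} [h : ENNReal.HolderTriple p q r] (hp : 2 ≤ p)
    (hq : 2 ≤ q) : 1 ≤ r := by
  rw [← ENNReal.inv_le_one, ← h.inv_add_inv_eq_inv, ← ENNReal.inv_two_add_inv_two]
  gcongr

variable {V : Type*} [NormedAddCommGroup V] [InnerProductSpace ℝ V] [FiniteDimensional ℝ V]

lemma pos_of_finrank_sub_one_mul_lt [Nontrivial V] {r : ℝ≥0∞} (hr : 1 ≤ r) {δ : ℝ}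
    (hδ : (Module.finrank ℝ V - 1 : ℝ) * (1 - (r⁻¹).toReal) < δ) : 0 < δ := by
  have hdim : (1 : ℝ) ≤ Module.finrank ℝ V := mod_cast Module.finrank_pos (R := ℝ) (M := V)
  have hr' : (r⁻¹).toReal ≤ 1 := ENNReal.toReal_mono ENNReal.one_ne_top (ENNReal.inv_le_one.2 hr)
  exact (mul_nonneg (sub_nonneg.2 hdim) (sub_nonneg.2 hr')).trans_lt hδ

variable [MeasurableSpace V] [BorelSpace V] {δ : ℝ} {p q r : ℝ≥0∞} [ENNReal.HolderTriple p q r]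

variable (V) in
lemma exists_eLpNorm_squareFn_mul_squareFn_le [Nontrivial V] (hp : 2 ≤ p) (hq : 2 ≤ q) {η : ℝ}
    (hη : 0 < η) :
    ∃ C : ℝ, 0 < C ∧ ∀ (j : ℕ) (f g : V → ℂ), MemLp f p → MemLp g q →
      eLpNorm (fun x => squareFn j f x * squareFn j g x) r volume ≤ ENNReal.ofReal (C * (2 ^ j) ^
        (Module.finrank ℝ V - (Module.finrank ℝ V - 1) * (r⁻¹).toReal + η : ℝ)) *
        (eLpNorm f p volume * eLpNorm g q volume) := by
  have hp0 : p ≠ 0 := (two_pos.trans_le hp).ne'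
  have hq0 : q ≠ 0 := (two_pos.trans_le hq).ne'
  obtain ⟨A, hA, hfA⟩ := exists_eLpNorm_squareFn_le V hp (half_pos hη)
  obtain ⟨B, hB, hgB⟩ := exists_eLpNorm_squareFn_le V hq (half_pos hη)
  refine ⟨A * B, mul_pos hA hB, fun j f g hf hg => ?_⟩
  have hr : (r⁻¹).toReal = (p⁻¹).toReal + (q⁻¹).toReal := by
    rw [← ENNReal.HolderTriple.inv_add_inv_eq_inv (p := p) (q := q) (r := r),
      ENNReal.toReal_add (ENNReal.inv_ne_top.2 hp0) (ENNReal.inv_ne_top.2 hq0)]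
  have hffin := ne_top_of_le_ne_top (ENNReal.mul_ne_top ENNReal.ofReal_ne_top hf.2.ne) (hfA j f hf)
  have hgfin := ne_top_of_le_ne_top (ENNReal.mul_ne_top ENNReal.ofReal_ne_top hg.2.ne) (hgB j g hg)
  refine (eLpNorm_ennreal_mul_le hp0 hq0 (measurable_squareFn j hf.1).aemeasurable
    (measurable_squareFn j hg.1).aemeasurable hffin hgfin).trans
    ((mul_le_mul' (hfA j f hf) (hgB j g hg)).trans_eq ?_)
  rw [mul_mul_mul_comm, ← ENNReal.ofReal_mul (by positivity), mul_mul_mul_comm,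
    ← Real.rpow_add (by positivity), hr]
  ring_nf

variable (V) in
theorem exists_eLpNorm_bromwichBilinAbs_le [Nontrivial V] (hp : 2 ≤ p) (hq : 2 ≤ q)
    (hδ : (Module.finrank ℝ V - 1 : ℝ) * (1 - (r⁻¹).toReal) < δ) :
    ∃ C : ℝ, 0 ≤ C ∧ ∀ f g : V → ℂ, MemLp f p → MemLp g q →
      eLpNorm (bromwichBilinAbs δ f g) r volume ≤
        ENNReal.ofReal C * (eLpNorm f p volume * eLpNorm g q volume) := by
  have hr := one_le_of_holderTriple (r := r) hp hq
  have hδ0 := pos_of_finrank_sub_one_mul_lt hr hδ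
  set η : ℝ := (δ - (Module.finrank ℝ V - 1) * (1 - (r⁻¹).toReal)) / 2 with hη
  have hη0 : 0 < η := half_pos (sub_pos.2 hδ)
  obtain ⟨A, hA, hblock⟩ := exists_eLpNorm_squareFn_mul_squareFn_le V (r := r) hp hq hη0
  set c : ℝ := Real.Gamma (δ + 1) * Real.exp 1
  have : 0 < c := mul_pos (Real.Gamma_pos_of_pos (by linarith)) (Real.exp_pos 1)
  have hgeom : (2 : ℝ) ^ (-η) < 1 :=
    Real.rpow_lt_one_of_one_lt_of_neg one_lt_two (neg_neg_of_pos hη0)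
  refine ⟨c * A * (1 - 2 ^ (-η))⁻¹,
    mul_nonneg (by positivity) (inv_nonneg.2 (sub_nonneg.2 hgeom.le)),
    fun f g hf hg => ?_⟩
  have hmeas (j : ℕ) : AEMeasurable (fun x => squareFn j f x * squareFn j g x) volume :=
    ((measurable_squareFn j hf.1).mul (measurable_squareFn j hg.1)).aemeasurable
  have hterm (j : ℕ) :
      eLpNorm (fun x => ENNReal.ofReal (c * (2 ^ j) ^ (-(δ + 1))) *
        (squareFn j f x * squareFn j g x)) r volume ≤
      ENNReal.ofReal (c * A * (2 ^ (-η)) ^ j) * (eLpNorm f p volume * eLpNorm g q volume) := by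
    refine (eLpNorm_le_mul_eLpNorm_of_ae_le_mul'' r (hmeas j).aestronglyMeasurable
      (Eventually.of_forall fun x => le_rfl)).trans
      ((mul_le_mul_right (hblock j f g hf hg) _).trans_eq ?_)
    rw [← mul_assoc, ← ENNReal.ofReal_mul (by positivity), mul_mul_mul_comm,
      ← Real.rpow_add (by positivity), Real.rpow_pow_comm two_pos.le]
    congr 4
    rw [hη]
    ring
  calc eLpNorm (bromwichBilinAbs δ f g) r volume
      ≤ eLpNorm (fun x => ∑' j : ℕ, ENNReal.ofReal (c * (2 ^ j) ^ (-(δ + 1))) *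
          (squareFn j f x * squareFn j g x)) r volume :=
        eLpNorm_mono_enorm fun x => bromwichBilinAbs_le_tsum hδ0 hf.1 hg.1 x
    _ ≤ ∑' j : ℕ, ENNReal.ofReal (c * A * (2 ^ (-η)) ^ j) *
          (eLpNorm f p volume * eLpNorm g q volume) :=
        (eLpNorm_tsum_le hr fun j => (hmeas j).const_mul _).trans
          (ENNReal.tsum_le_tsum hterm)
    _ = _ := by
        rw [ENNReal.tsum_mul_right, ← ENNReal.ofReal_tsum_of_nonneg (fun j => by positivity)
          ((summable_geometric_of_lt_one (by positivity) hgeom).mul_left _), tsum_mul_left,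
          tsum_geometric_of_lt_one (by positivity) hgeom]

lemma bromwichBilin_add_left {p r : ℝ≥0∞} {f₁ f₂ g : V → ℂ} (hp : 1 ≤ p) (hr : r ≠ 0)
    (hf₁ : MemLp f₁ p) (hf₂ : MemLp f₂ p) (hg : AEStronglyMeasurable g volume)
    (h₁ : eLpNorm (bromwichBilinAbs δ f₁ g) r volume ≠ ⊤)
    (h₂ : eLpNorm (bromwichBilinAbs δ f₂ g) r volume ≠ ⊤) :
    bromwichBilin δ (f₁ + f₂) g =ᵐ[volume] bromwichBilin δ f₁ g + bromwichBilin δ f₂ g := by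
  filter_upwards [ae_integrable_of_eLpNorm_bromwichBilinAbs_ne_top hr hf₁.1 hg h₁,
    ae_integrable_of_eLpNorm_bromwichBilinAbs_ne_top hr hf₂.1 hg h₂] with x hx₁ hx₂
  simp only [bromwichBilin, Pi.add_apply, ← integral_add hx₁ hx₂,
    heatOp_add (vertLine_re_pos _) hp hp hf₁ hf₂, add_mul, mul_add]

lemma eLpNorm_bromwichBilin_le (r : ℝ≥0∞) (f g : V → ℂ) :
    eLpNorm (bromwichBilin δ f g) r volume ≤ eLpNorm (bromwichBilinAbs δ f g) r volume :=
  eLpNorm_mono_enorm fun _ => enorm_integral_le_lintegral_enorm _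

variable (V) in
theorem exists_isBilinearOfStrongType_bromwichBilin [Nontrivial V] (hp : 2 ≤ p) (hq : 2 ≤ q)
    (hδ : (Module.finrank ℝ V - 1 : ℝ) * (1 - (r⁻¹).toReal) < δ) :
    ∃ C : ℝ, 0 ≤ C ∧
      IsBilinearOfStrongType ℂ (bromwichBilin (V := V) δ) p q r C volume volume volume := by
  obtain ⟨C, hC, hbound⟩ := exists_eLpNorm_bromwichBilinAbs_le V (r := r) hp hq hδ
  have hr : r ≠ 0 := (one_pos.trans_le (one_le_of_holderTriple hp hq)).ne'
  have hfin {f g : V → ℂ} (hf : MemLp f p) (hg : MemLp g q) :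
      eLpNorm (bromwichBilinAbs δ f g) r volume ≠ ⊤ := by
    have hrhs := ENNReal.mul_lt_top (ENNReal.ofReal_lt_top (r := C))
      (ENNReal.mul_lt_top hf.2 hg.2)
    exact ((hbound f g hf hg).trans_lt hrhs).ne
  refine ⟨C, hC, ?_⟩
  constructor
  case congr_ae => exact fun hf hg => .of_eq (bromwichBilin_congr_ae δ hf hg)
  case add_left =>
    exact fun hf₁ hf₂ hg => bromwichBilin_add_left (one_le_two.trans hp) hr hf₁ hf₂ hg.1
      (hfin hf₁ hg) (hfin hf₂ hg)
  case add_right =>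
    intro f g₁ g₂ hf hg₁ hg₂
    have h₁ := hfin hf hg₁
    have h₂ := hfin hf hg₂
    rw [bromwichBilinAbs_comm] at h₁ h₂
    simpa only [bromwichBilin_comm δ f] using
      bromwichBilin_add_left (one_le_two.trans hq) hr hg₁ hg₂ hf.1 h₁ h₂
  case smul_left => exact fun c f g _ _ => .of_eq (bromwichBilin_smul_left c f g)
  case smul_right =>
    intro c f g _ _
    rw [bromwichBilin_comm, bromwichBilin_smul_left, bromwichBilin_comm]
  case aestronglyMeasurable =>
    exact fun hf hg => (stronglyMeasurable_bromwichBilin hf.1 hg.1).aestronglyMeasurable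
  case eLpNorm_le =>
    exact fun hf hg => (eLpNorm_bromwichBilin_le r _ _).trans (hbound _ _ hf hg)

end BilinearBounds

section SchwartzMultiplier

variable {V : Type*} [NormedAddCommGroup V] [InnerProductSpace ℝ V] [FiniteDimensional ℝ V]
  [MeasurableSpace V] [BorelSpace V] {δ : ℝ}

lemma heatOp_schwartz_eq_integral {b : ℂ} (hb : 0 < b.re) (f : 𝓢(V, ℂ)) (x : V) :
    heatOp b f x = ∫ ξ, Complex.exp (2 * Real.pi * Complex.I * (inner ℝ x ξ : ℝ)) *
      Complex.exp (-b * ‖ξ‖ ^ 2) * 𝓕 f ξ := by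
  rw [heatOp_schwartz_eq hb, Real.fourierInv_eq']
  refine integral_congr_ae (Eventually.of_forall fun ξ => ?_)
  simp only [smul_eq_mul, real_inner_comm x ξ]
  push_cast
  ring_nf

lemma heatOp_mul_heatOp_schwartz_eq_integral {b : ℂ} (hb : 0 < b.re) (f g : 𝓢(V, ℂ)) (x : V) :
    heatOp b f x * heatOp b g x =
      ∫ z : V × V, Complex.exp (2 * Real.pi * Complex.I * (inner ℝ x (z.1 + z.2) : ℝ)) *
        Complex.exp (-b * (‖z.1‖ ^ 2 + ‖z.2‖ ^ 2 : ℝ)) * 𝓕 f z.1 * 𝓕 g z.2 := by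
  rw [heatOp_schwartz_eq_integral hb, heatOp_schwartz_eq_integral hb, Measure.volume_eq_prod,
    ← integral_prod_mul]
  refine integral_congr_ae (Eventually.of_forall fun z => ?_)
  simp only [inner_add_right, Complex.ofReal_add, Complex.ofReal_pow, mul_add, Complex.exp_add]
  ring

lemma integrable_bromwichDensity_mul_schwartz (hδ : 0 < δ) (f g : 𝓢(V, ℂ)) (x : V) :
    Integrable (fun w : ℝ × V × V => bromwichDensity δ w.1 *
      (Complex.exp (2 * Real.pi * Complex.I * (inner ℝ x (w.2.1 + w.2.2) : ℝ)) *
        Complex.exp (-vertLine w.1 * (‖w.2.1‖ ^ 2 + ‖w.2.2‖ ^ 2 : ℝ)) *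
        𝓕 f w.2.1 * 𝓕 g w.2.2)) := by
  have hdom : Integrable fun w : ℝ × V × V =>
      bromwichDensity δ w.1 * (𝓕 f w.2.1 * 𝓕 g w.2.2) :=
    (integrable_bromwichDensity hδ).mul_prod (g := fun z : V × V => 𝓕 f z.1 * 𝓕 g z.2)
      ((𝓕 f).integrable.mul_prod (𝓕 g).integrable)
  refine hdom.mono ?_ (Eventually.of_forall fun w => ?_)
  · have hdens := continuous_bromwichDensity (δ := δ)
    have hf := (𝓕 f).continuous
    have hg := (𝓕 g).continuous
    exact Continuous.aestronglyMeasurable (by fun_prop)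
  · have hgauss := norm_cexp_neg_mul_ofReal_le_one (vertLine_re_pos w.1).le
      (add_nonneg (sq_nonneg ‖w.2.1‖) (sq_nonneg ‖w.2.2‖))
    have hosc : ‖Complex.exp (2 * Real.pi * Complex.I * (inner ℝ x (w.2.1 + w.2.2) : ℝ))‖ = 1 := by
      simp [Complex.norm_exp]
    simp only [norm_mul, hosc, one_mul]
    gcongr _ * (?_ * _)
    exact mul_le_of_le_one_left (by positivity) hgauss

theorem bromwichBilin_schwartz_eq_integral (hδ : 0 < δ) (f g : 𝓢(V, ℂ)) (x : V) :
    bromwichBilin δ f g x =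
      ∫ z : V × V, Complex.exp (2 * Real.pi * Complex.I * (inner ℝ x (z.1 + z.2) : ℝ)) *
        ((max (1 - (‖z.1‖ ^ 2 + ‖z.2‖ ^ 2)) 0 ^ δ : ℝ) : ℂ) * 𝓕 f z.1 * 𝓕 g z.2 := by
  simp only [bromwichBilin, heatOp_mul_heatOp_schwartz_eq_integral (vertLine_re_pos _) f g x,
    ← integral_const_mul]
  rw [integral_integral_swap (integrable_bromwichDensity_mul_schwartz hδ f g x)]
  refine integral_congr_ae (Eventually.of_forall fun z => ?_)
  simp only [← integral_bromwichDensity_mul_cexp hδ, ← integral_const_mul, ← integral_mul_const]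
  refine integral_congr_ae (Eventually.of_forall fun t => ?_)
  ring

end SchwartzMultiplier

lemma bilinearBochnerRiesz_eq_bromwichBilin {n : ℕ} {δ : ℝ} (hδ : 0 < δ)
    (f g : 𝓢(EuclideanSpace ℝ (Fin n), ℂ)) :
    bilinearBochnerRiesz n δ f g = bromwichBilin δ f g := by
  ext x
  rw [bromwichBilin_schwartz_eq_integral hδ, bilinearBochnerRiesz,
    ← integral_indicator (measurableSet_le (by fun_prop) (by fun_prop))]
  refine integral_congr_ae (Eventually.of_forall fun z => ?_)
  beta_reduce
  by_cases hz : ‖z.1‖ ^ 2 + ‖z.2‖ ^ 2 ≤ 1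
  · rw [indicator_of_mem (by exact hz), max_eq_left (sub_nonneg.2 hz), sub_sub]
  · rw [indicator_of_notMem (by exact hz), max_eq_right (by linarith), Real.zero_rpow hδ.ne']
    simp

theorem mainTheorem11_general (n : ℕ) (hn : 1 ≤ n) (p q r : ℝ≥0∞) [ENNReal.HolderTriple p q r]
    (δ : ℝ) (hp : 2 ≤ p) (hq : 2 ≤ q) (hδ : ((n : ℝ) - 1) * (1 - (r⁻¹).toReal) < δ) :
    IsBoundedBilinear (bilinearBochnerRiesz n δ) p q r := by
  have : Nonempty (Fin n) := ⟨⟨0, hn⟩⟩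
  rw [← finrank_euclideanSpace_fin (𝕜 := ℝ) (n := n)] at hδ
  have hδ0 : 0 < δ := pos_of_finrank_sub_one_mul_lt (one_le_of_holderTriple hp hq) hδ
  obtain ⟨C, hC, hT⟩ := exists_isBilinearOfStrongType_bromwichBilin
    (EuclideanSpace ℝ (Fin n)) (r := r) hp hq hδ
  obtain ⟨B, hB, hBT⟩ := hT.exists_linearMap_Lp hC
  refine ⟨B, ⟨C, hB⟩, fun f g => (hBT _ _).trans (.of_eq ?_)⟩
  rw [bilinearBochnerRiesz_eq_bromwichBilin hδ0,
    bromwichBilin_congr_ae δ (f.coeFn_toLp p volume) (g.coeFn_toLp q volume)]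

theorem mainTheorem11 (n : ℕ) (hn : 1 ≤ n) (p q r r' δ : ℝ)
    (hp : 2 ≤ p) (hq : 2 ≤ q) (hr' : 2 ≤ r')
    (hpqr : 1 / p + 1 / q + 1 / r' = 1) (hrr' : 1 / r + 1 / r' = 1)
    (hδ : ((n : ℝ) - 1) / r' < δ) :
    IsBoundedBilinear (bilinearBochnerRiesz n δ)
      (ENNReal.ofReal p) (ENNReal.ofReal q) (ENNReal.ofReal r) := by
  simp only [one_div] at hpqr hrr'
  have hpq : p.HolderTriple q r := ⟨by linarith, by linarith, by linarith⟩
  have := hpq.ennrealOfReal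
  refine mainTheorem11_general n hn _ _ _ δ (by simpa using ENNReal.ofReal_le_ofReal hp)
    (by simpa using ENNReal.ofReal_le_ofReal hq) ?_
  rwa [ENNReal.toReal_inv, ENNReal.toReal_ofReal hpq.nonneg', ← eq_sub_of_add_eq' hrr',
    ← div_eq_mul_inv]
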